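/- Let $K\ge 1$ sensors and a horizon $N\ge 0$ be given. The hypothesis $\mathcal H\in\{0,1\}$ has prior probabilities $\pi_0,\pi_1>0$, $\pi_0+\pi_1=1$. Under $\mathcal H=i$ a sample of sensor $\ell$ has a known density $f_i^\ell$ with respect to a $\sigma$-finite reference measure $\nu$ (for instance Lebesgue measure), where for each $\ell$ the densities $f_0^\ell$ and $f_1^\ell$ vanish at the same points up to a $\nu$-null set, and $l_\ell=\log(f_1^\ell/f_0^\ell)$. A sequential procedure with at most $N$ samples consists of sensor selections $\delta_{t+1}\in\{1,\dots,K\}$, where $\delta_{t+1}$ is a function of $X_1,\dots,X_t$, a (deterministic) stopping time $\mathsf T\le N$, where $\{\mathsf T=t\}$ is determined by $X_1,\dots,X_t$, and a decision $D\in\{0,1\}$ determined by $X_1,\dots,X_{\mathsf T}$. Under $\mathcal H=i$, given the past, $X_{t+1}$ has density $f_i^{\delta_{t+1}}$. Let $\mu_0,\mu_1>0$, let $\Omega$ be a set of sensors with multipliers $\lambda_\ell\ge0$ for $\ell\in\Omega$, and put $\mathcal C_\ell=1+\lambda_\ell$ for $\ell\in\Omega$ and $\mathcal C_\ell=1$ otherwise.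 The Bayes problem is to minimize, over all procedures with at most $N$ samples, $$\mathcal R=\mathbb E\Big(\sum_{t=1}^{\mathsf T}\mathcal C_{\delta_t}+\mu_0\mathbf 1_{\{D=1,\mathcal H=0\}}+\mu_1\mathbf 1_{\{D=0,\mathcal H=1\}}\Big).$$ Let $L_t=\sum_{s=1}^t l_{\delta_s}(X_s)$. Theorem. There are measurable functions $\psi_1,\psi_2,\dots:\mathbb R\to\{1,\dots,K\}$, real numbers $A_0,\dots,A_N$ and $B_0,\dots,B_N$, and a procedure attaining the minimum of $\mathcal R$ such that: 1. The sensor selection is a time-varying function of the log-likelihood ratio: $\delta_{t+1}=\psi_{t+1}(L_t)$ for $0\le t<N$. 2. The stopping rule is a truncated SPRT, $\mathsf T=\min\{t: L_t\notin(-A_t,B_t)\}$, where $B_N=-A_N=\log\frac{\mu_0\pi_0}{\mu_1\pi_1}$, and $A_0\ge A_1\ge\dots\ge A_N$ and $B_0\ge B_1\ge\dots\ge B_N$. These inequalities are strict, $A_0>A_1>\dots>A_N$ and $B_0>B_1>\dots>B_N$, whenever (a) $\mathcal C_\ell<\frac{\mu_0\mu_1}{\mu_0+\mu_1}\cdot\frac12\int|f_1^\ell-f_0^\ell|\,d\nu$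 for some sensor $\ell$ (that is, at the posterior where both decisions have the same expected penalty, one further sample is worth its cost), and (b) for every sensor $\ell$ and every $\varepsilon>0$, each of the events $0<l_\ell(X)<\varepsilon$ and $-\varepsilon<l_\ell(X)<0$ has positive probability for a sample $X$ of sensor $\ell$. 3. The decision is $\mathcal H_0$ if $L_{\mathsf T}\le-A_{\mathsf T}$ and $\mathcal H_1$ if $L_{\mathsf T}\ge B_{\mathsf T}$ (in case of a tie $L_{\mathsf T}=-A_{\mathsf T}=B_{\mathsf T}$ the decision is $\mathcal H_1$). -/

import Mathlib

open MeasureTheory Set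

namespace SensorTest

/-- Conditional densities `f i ℓ` (hypothesis `i`, sensor `ℓ`) with respect to a reference measure
`ν` on the sample space. For each sensor the two densities vanish at the same points (up to a
`ν`-null set), so that the log-likelihood ratio of a sample is almost surely finite. -/
structure IsSensorFamily {𝓧 : Type*} [MeasurableSpace 𝓧] (ν : Measure 𝓧) {K : ℕ}
    (f : Fin 2 → Fin K → 𝓧 → ℝ) : Prop where
  measurable : ∀ i ℓ, Measurable (f i ℓ)
  nonneg : ∀ i ℓ x, 0 ≤ f i ℓ x
  lintegral_eq_one : ∀ i ℓ, ∫⁻ x, ENNReal.ofReal (f i ℓ x) ∂ν = 1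
  zero_iff : ∀ ℓ, ∀ᵐ x ∂ν, f 0 ℓ x = 0 ↔ f 1 ℓ x = 0

/-- The law of one sample of sensor `ℓ` under hypothesis `i`. -/
noncomputable def sensorLaw {𝓧 : Type*} [MeasurableSpace 𝓧] (ν : Measure 𝓧) {K : ℕ}
    (f : Fin 2 → Fin K → 𝓧 → ℝ) (i : Fin 2) (ℓ : Fin K) : Measure 𝓧 :=
  ν.withDensity fun x => ENNReal.ofReal (f i ℓ x)

/-- The log-likelihood ratio `l_ℓ(x) = log (f₁^ℓ(x) / f₀^ℓ(x))` of a sample `x` of sensor `ℓ`. -/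
noncomputable def sampleLLR {𝓧 : Type*} {K : ℕ} (f : Fin 2 → Fin K → 𝓧 → ℝ)
    (ℓ : Fin K) (x : 𝓧) : ℝ :=
  Real.log (f 1 ℓ x / f 0 ℓ x)

/-- The cost of one sample of sensor `j`: `1 + λ_j` if `j ∈ Ω`, and `1` otherwise. -/
def sampleCost {K : ℕ} (Ω : Finset (Fin K)) (lam : Fin K → ℝ) (j : Fin K) : ℝ :=
  1 + if j ∈ Ω then lam j else 0

/-- A sequential procedure with at most `N` samples. A sample path is `x : Fin N → 𝓧`, whose entry
`x s` is the sample `X_{s+1}`; thus `X_1, …, X_t` are the entries `x s` with `s < t`.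
* `select t` is the sensor `δ_{t+1}` that takes the sample `X_{t+1}`; it is a measurable function
  of `X_1, …, X_t`.
* `time` is the stopping time `T ≤ N`; whether `T = t` is determined by `X_1, …, X_t`.
* `decide` is the accepted hypothesis, determined by the samples `X_1, …, X_T`. -/
structure Procedure (K N : ℕ) (𝓧 : Type*) [MeasurableSpace 𝓧] where
  select : Fin N → (Fin N → 𝓧) → Fin K
  time : (Fin N → 𝓧) → ℕ
  decide : (Fin N → 𝓧) → Fin 2
  measurable_select : ∀ t, Measurable (select t)
  measurable_time : Measurable time
  measurable_decide : Measurable decide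
  time_le : ∀ x, time x ≤ N
  select_adapted : ∀ (t : Fin N) (x y : Fin N → 𝓧),
    (∀ s, s < t → x s = y s) → select t x = select t y
  time_adapted : ∀ x y : Fin N → 𝓧,
    (∀ s : Fin N, (s : ℕ) < time x → x s = y s) → time x = time y
  decide_adapted : ∀ x y : Fin N → 𝓧,
    (∀ s : Fin N, (s : ℕ) < time x → x s = y s) → decide x = decide y

namespace Procedure

variable {K N : ℕ} {𝓧 : Type*} [MeasurableSpace 𝓧]

/-- The joint law of the samples under hypothesis `i`: given `X_1, …, X_t`, the sample `X_{t+1}`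
has density `f_i^{δ_{t+1}}`. -/
noncomputable def pathLaw (P : Procedure K N 𝓧) (ν : Measure 𝓧) (f : Fin 2 → Fin K → 𝓧 → ℝ)
    (i : Fin 2) : Measure (Fin N → 𝓧) :=
  (Measure.pi fun _ : Fin N => ν).withDensity fun x =>
    ENNReal.ofReal (∏ t : Fin N, f i (P.select t x) (x t))

/-- The cumulative log-likelihood ratio `L_t = ∑_{s=1}^t l_{δ_s}(X_s)`. -/
noncomputable def llr (P : Procedure K N 𝓧) (f : Fin 2 → Fin K → 𝓧 → ℝ) (t : ℕ)
    (x : Fin N → 𝓧) : ℝ :=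
  ∑ s ∈ Finset.univ.filter (fun s : Fin N => (s : ℕ) < t), sampleLLR f (P.select s x) (x s)

/-- The Bayes risk
`E (∑_{t=1}^T C_{δ_t} + μ_0 1{D = 1, H = 0} + μ_1 1{D = 0, H = 1})`,
where hypothesis `i` has prior probability `prior i`. -/
noncomputable def risk (P : Procedure K N 𝓧) (ν : Measure 𝓧) (f : Fin 2 → Fin K → 𝓧 → ℝ)
    (prior μ : Fin 2 → ℝ) (Ω : Finset (Fin K)) (lam : Fin K → ℝ) : ℝ :=
  ∑ i : Fin 2, prior i * ∫ x,
    ((∑ t ∈ Finset.univ.filter (fun t : Fin N => (t : ℕ) < P.time x),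
        sampleCost Ω lam (P.select t x))
      + if P.decide x = i then 0 else μ i) ∂(P.pathLaw ν f i)

/-- `P` solves the finite-horizon Bayes problem: its risk is minimal among all procedures with at
most `N` samples. -/
def IsOptimal (P : Procedure K N 𝓧) (ν : Measure 𝓧) (f : Fin 2 → Fin K → 𝓧 → ℝ)
    (prior μ : Fin 2 → ℝ) (Ω : Finset (Fin K)) (lam : Fin K → ℝ) : Prop :=
  ∀ Q : Procedure K N 𝓧, P.risk ν f prior μ Ω lam ≤ Q.risk ν f prior μ Ω lam

end Procedure

end SensorTest

/-! The proof is backward induction on unnormalised weights `p` of the two hypotheses. A sample `x`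
of sensor `ℓ` turns `p i` into `p i * f i ℓ x`, so no posterior has to be normalised. The cost to go
is monotone and homogeneous of degree one in `p`, and it decreases as more samples become available.

By homogeneity only the ray through `(π₀, π₁ e^z)` matters, where `z` is the log-likelihood ratio.
Let `s` be the point where both decisions have equal penalty. To the right of `s` the stopping cost
is the constant `μ₀π₀`, while the cost of continuing is continuous and strictly increasing in `z`,
because each sample is paid per unit of total weight. Hence continuing is better exactly below a
threshold (`exists_upper_thresholds`). Exchanging the hypotheses gives the left side
(`exists_thresholds`). More remaining samples make continuing cheaper, so the thresholds widen.
Under (b), a sample can land between two consecutive thresholds, where one more remaining sample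
strictly helps, so strictness propagates from its first instance, supplied by (a).

Conditioning on the first sample shows that no procedure beats the value function
(`value_le_weightedRisk`) and that the threshold procedure attains it
(`Procedure.IsThreshold.weightedRisk_eq`). -/

namespace SensorTest

/-! ### Dynamic programming on unnormalised weights. -/

variable {𝓧 : Type*} [MeasurableSpace 𝓧] {ν : Measure 𝓧} {K : ℕ}
  {f : Fin 2 → Fin K → 𝓧 → ℝ} {μ : Fin 2 → ℝ} {C : Fin K → ℝ} {U U' : (Fin 2 → ℝ) → ℝ}

/-- The expected penalty of the better decision, when hypothesis `i` has weight `p i`. -/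
noncomputable def stopValue (μ p : Fin 2 → ℝ) : ℝ := min (μ 0 * p 0) (μ 1 * p 1)

/-- The cost of taking one sample of sensor `ℓ` at weights `p`, if the cost to go is `U`. -/
noncomputable def sampleValue (ν : Measure 𝓧) (f : Fin 2 → Fin K → 𝓧 → ℝ) (C : Fin K → ℝ)
    (U : (Fin 2 → ℝ) → ℝ) (ℓ : Fin K) (p : Fin 2 → ℝ) : ℝ :=
  C ℓ * (p 0 + p 1) + ∫ x, U (fun i => p i * f i ℓ x) ∂ν

/-- The cost of taking one sample of the best sensor. -/
noncomputable def continueValue [NeZero K] (ν : Measure 𝓧) (f : Fin 2 → Fin K → 𝓧 → ℝ)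
    (C : Fin K → ℝ) (U : (Fin 2 → ℝ) → ℝ) (p : Fin 2 → ℝ) : ℝ :=
  Finset.univ.inf' Finset.univ_nonempty fun ℓ => sampleValue ν f C U ℓ p

/-- The optimal cost to go at weights `p` when at most `n` further samples may be taken. -/
noncomputable def value [NeZero K] (ν : Measure 𝓧) (f : Fin 2 → Fin K → 𝓧 → ℝ)
    (μ : Fin 2 → ℝ) (C : Fin K → ℝ) : ℕ → (Fin 2 → ℝ) → ℝ
  | 0, p => stopValue μ p
  | n + 1, p => min (stopValue μ p) (continueValue ν f C (value ν f μ C n) p)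

/-- The properties of a cost to go that are preserved by dynamic programming. -/
structure IsCostToGo (μ : Fin 2 → ℝ) (U : (Fin 2 → ℝ) → ℝ) : Prop where
  measurable : Measurable U
  nonneg : ∀ p, 0 ≤ p → 0 ≤ U p
  le_stopValue : ∀ p, 0 ≤ p → U p ≤ stopValue μ p
  mono : ∀ p q, 0 ≤ p → p ≤ q → U p ≤ U q
  smul : ∀ (c : ℝ) p, 0 ≤ c → U (c • p) = c * U p

theorem IsSensorFamily.integrable (hf : IsSensorFamily ν f) (i : Fin 2) (ℓ : Fin K) :
    Integrable (f i ℓ) ν := by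
  refine ⟨(hf.measurable i ℓ).aestronglyMeasurable, ?_⟩
  rw [hasFiniteIntegral_iff_ofReal (ae_of_all _ (hf.nonneg i ℓ)), hf.lintegral_eq_one]
  exact ENNReal.one_lt_top

theorem IsSensorFamily.integral_eq_one (hf : IsSensorFamily ν f) (i : Fin 2) (ℓ : Fin K) :
    ∫ x, f i ℓ x ∂ν = 1 := by
  rw [integral_eq_lintegral_of_nonneg_ae (ae_of_all _ (hf.nonneg i ℓ))
    (hf.measurable i ℓ).aestronglyMeasurable, hf.lintegral_eq_one, ENNReal.toReal_one]

/-- Exchanging the two hypotheses. -/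
theorem IsSensorFamily.rev (hf : IsSensorFamily ν f) : IsSensorFamily ν fun i => f i.rev where
  measurable i := hf.measurable i.rev
  nonneg i := hf.nonneg i.rev
  lintegral_eq_one i := hf.lintegral_eq_one i.rev
  zero_iff ℓ := (hf.zero_iff ℓ).mono fun _ h => h.symm

theorem IsSensorFamily.mul_nonneg (hf : IsSensorFamily ν f) {p : Fin 2 → ℝ} (hp : 0 ≤ p)
    (ℓ : Fin K) (x : 𝓧) : (0 : Fin 2 → ℝ) ≤ fun i => p i * f i ℓ x :=
  fun i => _root_.mul_nonneg (hp i) (hf.nonneg i ℓ x)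

theorem stopValue_rev (p : Fin 2 → ℝ) :
    stopValue (fun i => μ i.rev) (fun i => p i.rev) = stopValue μ p := by
  simp only [stopValue]
  exact min_comm _ _

theorem isCostToGo_stopValue (hμ : ∀ i, 0 < μ i) : IsCostToGo μ (stopValue μ) where
  measurable := by unfold stopValue; fun_prop
  nonneg p hp := le_min (mul_nonneg (hμ 0).le (hp 0)) (mul_nonneg (hμ 1).le (hp 1))
  le_stopValue _ _ := le_rfl
  mono p q _ hpq := min_le_min (mul_le_mul_of_nonneg_left (hpq 0) (hμ 0).le)
    (mul_le_mul_of_nonneg_left (hpq 1) (hμ 1).le)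
  smul c p hc := by
    simp only [stopValue, Pi.smul_apply, smul_eq_mul, mul_min_of_nonneg _ _ hc]
    congr 1 <;> ring

theorem IsCostToGo.measurable_update (hU : IsCostToGo μ U) (hf : IsSensorFamily ν f) (ℓ : Fin K) :
    Measurable fun z : (Fin 2 → ℝ) × 𝓧 => U (fun i => z.1 i * f i ℓ z.2) := by
  refine hU.measurable.comp (measurable_pi_lambda _ fun i => ?_)
  exact ((measurable_pi_apply i).comp measurable_fst).mul
    ((hf.measurable i ℓ).comp measurable_snd)

theorem IsCostToGo.integrable_update (hU : IsCostToGo μ U) (hf : IsSensorFamily ν f)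
    {p : Fin 2 → ℝ} (hp : 0 ≤ p) (ℓ : Fin K) :
    Integrable (fun x => U (fun i => p i * f i ℓ x)) ν := by
  refine Integrable.mono' (((hf.integrable 0 ℓ).const_mul (p 0)).const_mul (μ 0))
    ((hU.measurable_update hf ℓ).comp measurable_prodMk_left).aestronglyMeasurable
    (ae_of_all _ fun x => ?_)
  have h := hf.mul_nonneg hp ℓ x
  rw [Real.norm_of_nonneg (hU.nonneg _ h)]
  exact (hU.le_stopValue _ h).trans (min_le_left _ _)

theorem IsCostToGo.integral_update_mono (hU : IsCostToGo μ U) (hf : IsSensorFamily ν f)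
    {p q : Fin 2 → ℝ} (hp : 0 ≤ p) (hpq : p ≤ q) (ℓ : Fin K) :
    ∫ x, U (fun i => p i * f i ℓ x) ∂ν ≤ ∫ x, U (fun i => q i * f i ℓ x) ∂ν :=
  integral_mono (hU.integrable_update hf hp ℓ) (hU.integrable_update hf (hp.trans hpq) ℓ)
    fun x => hU.mono _ _ (hf.mul_nonneg hp ℓ x)
      fun i => mul_le_mul_of_nonneg_right (hpq i) (hf.nonneg i ℓ x)

theorem IsCostToGo.measurable_sampleValue [SFinite ν] (hU : IsCostToGo μ U)
    (hf : IsSensorFamily ν f) (ℓ : Fin K) : Measurable (sampleValue ν f C U ℓ) := by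
  have h := (hU.measurable_update hf ℓ).stronglyMeasurable.integral_prod_right' (ν := ν)
  unfold sampleValue
  have := h.measurable
  fun_prop

theorem IsCostToGo.sampleValue_smul (hU : IsCostToGo μ U) (ℓ : Fin K) {c : ℝ} (hc : 0 ≤ c)
    (p : Fin 2 → ℝ) : sampleValue ν f C U ℓ (c • p) = c * sampleValue ν f C U ℓ p := by
  have : ∀ x, U (fun i => (c • p) i * f i ℓ x) = c * U (fun i => p i * f i ℓ x) := fun x => by
    rw [← hU.smul _ _ hc]
    congr 1; ext i; simp [mul_assoc]
  simp only [sampleValue, this, integral_const_mul]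
  simp only [Pi.smul_apply, smul_eq_mul]
  ring

theorem IsCostToGo.sampleValue_mono (hC : ∀ ℓ, 1 ≤ C ℓ) (hU : IsCostToGo μ U)
    (hf : IsSensorFamily ν f) (ℓ : Fin K) {p q : Fin 2 → ℝ} (hp : 0 ≤ p) (hpq : p ≤ q) :
    sampleValue ν f C U ℓ p ≤ sampleValue ν f C U ℓ q := by
  have h0 : (0 : ℝ) ≤ C ℓ := zero_le_one.trans (hC ℓ)
  exact add_le_add (mul_le_mul_of_nonneg_left (add_le_add (hpq 0) (hpq 1)) h0)
    (hU.integral_update_mono hf hp hpq ℓ)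

/-- Strictness comes from the sampling cost alone; the integral term is merely monotone. -/
theorem IsCostToGo.sampleValue_strictMono (hC : ∀ ℓ, 1 ≤ C ℓ) (hU : IsCostToGo μ U)
    (hf : IsSensorFamily ν f) (ℓ : Fin K) {p q : Fin 2 → ℝ} (hp : 0 ≤ p) (hpq : p ≤ q)
    (h : p 1 < q 1) : sampleValue ν f C U ℓ p < sampleValue ν f C U ℓ q := by
  have h0 : (0 : ℝ) < C ℓ := zero_lt_one.trans_le (hC ℓ)
  exact add_lt_add_of_lt_of_le (mul_lt_mul_of_pos_left (add_lt_add_of_le_of_lt (hpq 0) h) h0)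
    (hU.integral_update_mono hf hp hpq ℓ)

theorem IsCostToGo.le_sampleValue (hC : ∀ ℓ, 1 ≤ C ℓ) (hU : IsCostToGo μ U)
    (hf : IsSensorFamily ν f) (ℓ : Fin K) {p : Fin 2 → ℝ} (hp : 0 ≤ p) :
    p 0 + p 1 ≤ sampleValue ν f C U ℓ p := by
  have h1 : p 0 + p 1 ≤ C ℓ * (p 0 + p 1) :=
    le_mul_of_one_le_left (add_nonneg (hp 0) (hp 1)) (hC ℓ)
  have h2 : 0 ≤ ∫ x, U (fun i => p i * f i ℓ x) ∂ν :=
    integral_nonneg fun x => hU.nonneg _ (hf.mul_nonneg hp ℓ x)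
  unfold sampleValue
  linarith

variable [NeZero K]

theorem continueValue_le (ℓ : Fin K) (p : Fin 2 → ℝ) :
    continueValue ν f C U p ≤ sampleValue ν f C U ℓ p :=
  Finset.inf'_le _ (Finset.mem_univ ℓ)

theorem exists_continueValue_eq (p : Fin 2 → ℝ) :
    ∃ ℓ, continueValue ν f C U p = sampleValue ν f C U ℓ p := by
  obtain ⟨ℓ, -, h⟩ := Finset.exists_mem_eq_inf' (Finset.univ_nonempty (α := Fin K))
    fun ℓ => sampleValue ν f C U ℓ p
  exact ⟨ℓ, h⟩

theorem IsCostToGo.continueValue_smul (hU : IsCostToGo μ U) {c : ℝ} (hc : 0 ≤ c)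
    (p : Fin 2 → ℝ) : continueValue ν f C U (c • p) = c * continueValue ν f C U p := by
  apply le_antisymm
  · obtain ⟨ℓ, h⟩ := exists_continueValue_eq (ν := ν) (f := f) (C := C) (U := U) p
    rw [h, ← hU.sampleValue_smul ℓ hc]
    exact continueValue_le ℓ _
  · obtain ⟨ℓ, h⟩ := exists_continueValue_eq (ν := ν) (f := f) (C := C) (U := U) (c • p)
    rw [h, hU.sampleValue_smul ℓ hc]
    exact mul_le_mul_of_nonneg_left (continueValue_le ℓ _) hc

theorem IsCostToGo.continueValue_mono (hC : ∀ ℓ, 1 ≤ C ℓ) (hU : IsCostToGo μ U)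
    (hf : IsSensorFamily ν f) {p q : Fin 2 → ℝ} (hp : 0 ≤ p) (hpq : p ≤ q) :
    continueValue ν f C U p ≤ continueValue ν f C U q := by
  obtain ⟨ℓ, h⟩ := exists_continueValue_eq (ν := ν) (f := f) (C := C) (U := U) q
  exact h ▸ (continueValue_le ℓ _).trans (hU.sampleValue_mono hC hf ℓ hp hpq)

theorem IsCostToGo.continueValue_strictMono (hC : ∀ ℓ, 1 ≤ C ℓ) (hU : IsCostToGo μ U)
    (hf : IsSensorFamily ν f) {p q : Fin 2 → ℝ} (hp : 0 ≤ p) (hpq : p ≤ q) (hlt : p 1 < q 1) :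
    continueValue ν f C U p < continueValue ν f C U q := by
  obtain ⟨ℓ, h⟩ := exists_continueValue_eq (ν := ν) (f := f) (C := C) (U := U) q
  exact h ▸ (continueValue_le ℓ _).trans_lt (hU.sampleValue_strictMono hC hf ℓ hp hpq hlt)

theorem IsCostToGo.le_continueValue (hC : ∀ ℓ, 1 ≤ C ℓ) (hU : IsCostToGo μ U)
    (hf : IsSensorFamily ν f) {p : Fin 2 → ℝ} (hp : 0 ≤ p) :
    p 0 + p 1 ≤ continueValue ν f C U p := by
  obtain ⟨ℓ, h⟩ := exists_continueValue_eq (ν := ν) (f := f) (C := C) (U := U) p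
  exact h ▸ hU.le_sampleValue hC hf ℓ hp

theorem continueValue_mono_costToGo (hU : IsCostToGo μ U) (hU' : IsCostToGo μ U')
    (hf : IsSensorFamily ν f) (h : ∀ p, 0 ≤ p → U p ≤ U' p) {p : Fin 2 → ℝ} (hp : 0 ≤ p) :
    continueValue ν f C U p ≤ continueValue ν f C U' p := by
  obtain ⟨ℓ, h'⟩ := exists_continueValue_eq (ν := ν) (f := f) (C := C) (U := U') p
  refine h' ▸ (continueValue_le ℓ _).trans (add_le_add_right ?_ _)
  exact integral_mono (hU.integrable_update hf hp ℓ) (hU'.integrable_update hf hp ℓ)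
    fun x => h _ (hf.mul_nonneg hp ℓ x)

theorem isCostToGo_value [SFinite ν] (hf : IsSensorFamily ν f) (hμ : ∀ i, 0 < μ i)
    (hC : ∀ ℓ, 1 ≤ C ℓ) (n : ℕ) : IsCostToGo μ (value ν f μ C n) := by
  have hs := isCostToGo_stopValue hμ
  induction n with
  | zero => exact hs
  | succ n ih =>
    refine ⟨?_, fun p hp => ?_, fun p _ => min_le_left _ _, fun p q hp hpq => ?_,
      fun c p hc => ?_⟩
    · refine hs.measurable.min ?_
      have : Measurable (Finset.univ.inf' (Finset.univ_nonempty (α := Fin K))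
          fun ℓ => sampleValue ν f C (value ν f μ C n) ℓ) :=
        Finset.inf'_induction _ _ (fun _ h _ h' => h.inf h')
          fun ℓ _ => ih.measurable_sampleValue hf ℓ
      convert this using 1
      ext p
      simp [continueValue, Finset.inf'_apply]
    · exact le_min (hs.nonneg p hp)
        ((add_nonneg (hp 0) (hp 1)).trans (ih.le_continueValue hC hf hp))
    · exact min_le_min (hs.mono p q hp hpq) (ih.continueValue_mono hC hf hp hpq)
    · simp only [value]
      rw [hs.smul c p hc, ih.continueValue_smul hc, mul_min_of_nonneg _ _ hc]

theorem value_succ_le [SFinite ν] (hf : IsSensorFamily ν f) (hμ : ∀ i, 0 < μ i)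
    (hC : ∀ ℓ, 1 ≤ C ℓ) (n : ℕ) {p : Fin 2 → ℝ} (hp : 0 ≤ p) :
    value ν f μ C (n + 1) p ≤ value ν f μ C n p := by
  induction n generalizing p with
  | zero => exact min_le_left _ _
  | succ n ih =>
    exact min_le_min le_rfl (continueValue_mono_costToGo (isCostToGo_value hf hμ hC _)
      (isCostToGo_value hf hμ hC _) hf (fun p hp => ih hp) hp)

/-- The problem is symmetric under exchange of the hypotheses; this is what transfers upper
thresholds to lower ones. -/
theorem continueValue_rev {U U' : (Fin 2 → ℝ) → ℝ} (h : ∀ p, U' (fun i => p i.rev) = U p)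
    (p : Fin 2 → ℝ) : continueValue ν (fun i => f i.rev) C U' (fun i => p i.rev)
      = continueValue ν f C U p := by
  have : ∀ ℓ, sampleValue ν (fun i => f i.rev) C U' ℓ (fun i => p i.rev)
      = sampleValue ν f C U ℓ p := fun ℓ => by
    simp only [sampleValue]
    congr 1
    · rw [add_comm (p 0)]; rfl
    · exact integral_congr_ae (ae_of_all _ fun x => h fun i => p i * f i ℓ x)
  simp only [continueValue, this]

theorem value_rev (n : ℕ) (p : Fin 2 → ℝ) :
    value ν (fun i => f i.rev) (fun i => μ i.rev) C n (fun i => p i.rev) = value ν f μ C n p := by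
  induction n generalizing p with
  | zero => exact stopValue_rev p
  | succ n ih => simp only [value, stopValue_rev, continueValue_rev ih]

end SensorTest
-- The continuation region along the log-likelihood ratio.
namespace SensorTest

variable {𝓧 : Type*} [MeasurableSpace 𝓧] {ν : Measure 𝓧} {K : ℕ}
  {f : Fin 2 → Fin K → 𝓧 → ℝ} {μ : Fin 2 → ℝ} {C : Fin K → ℝ} {U : (Fin 2 → ℝ) → ℝ}
  {prior : Fin 2 → ℝ}

/-- The weights of the two hypotheses at log-likelihood ratio `z`, up to a common factor. -/
noncomputable def llrWeight (prior : Fin 2 → ℝ) (z : ℝ) : Fin 2 → ℝ :=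
  ![prior 0, prior 1 * Real.exp z]

theorem llrWeight_nonneg (hprior : ∀ i, 0 < prior i) (z : ℝ) : 0 ≤ llrWeight prior z :=
  Fin.forall_fin_two.2 ⟨(hprior 0).le, mul_nonneg (hprior 1).le (Real.exp_pos z).le⟩

theorem llrWeight_mono (hprior : ∀ i, 0 < prior i) {z z' : ℝ} (h : z ≤ z') :
    llrWeight prior z ≤ llrWeight prior z' :=
  Fin.forall_fin_two.2
    ⟨le_rfl, mul_le_mul_of_nonneg_left (Real.exp_le_exp.2 h) (hprior 1).le⟩

/-- With homogeneity, this bounds the growth of a cost in `z` by an exponential factor, which yields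
continuity below. -/
theorem llrWeight_le_smul (hprior : ∀ i, 0 < prior i) {z z' : ℝ} (h : z ≤ z') :
    llrWeight prior z' ≤ Real.exp (z' - z) • llrWeight prior z := by
  refine Fin.forall_fin_two.2 ⟨?_, ?_⟩
  · simpa [llrWeight] using le_mul_of_one_le_left (hprior 0).le (Real.one_le_exp (sub_nonneg.2 h))
  · simp [llrWeight, Real.exp_sub]
    field_simp
    exact le_rfl

theorem llrWeight_rev (z : ℝ) :
    llrWeight prior z
      = Real.exp z • fun i : Fin 2 => llrWeight (fun i => prior i.rev) (-z) i.rev := by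
  ext i
  fin_cases i <;> simp [llrWeight, Real.exp_neg] <;> field_simp

theorem measurable_llrWeight : Measurable (llrWeight prior) := by
  refine measurable_pi_lambda _ (Fin.forall_fin_two.2 ⟨?_, ?_⟩)
  · exact measurable_const
  · exact measurable_const.mul Real.measurable_exp

theorem mul_llrWeight_le_iff (hprior : ∀ i, 0 < prior i) (hμ : ∀ i, 0 < μ i) {z : ℝ} :
    μ 0 * prior 0 ≤ μ 1 * (prior 1 * Real.exp z) ↔
      Real.log (μ 0 * prior 0 / (μ 1 * prior 1)) ≤ z := by
  have h0 := mul_pos (hμ 0) (hprior 0)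
  have h1 := mul_pos (hμ 1) (hprior 1)
  rw [Real.log_le_iff_le_exp (div_pos h0 h1), div_le_iff₀ h1]
  ring_nf

theorem stopValue_llrWeight_of_le (hprior : ∀ i, 0 < prior i) (hμ : ∀ i, 0 < μ i) {z : ℝ}
    (hz : Real.log (μ 0 * prior 0 / (μ 1 * prior 1)) ≤ z) :
    stopValue μ (llrWeight prior z) = μ 0 * prior 0 :=
  min_eq_left ((mul_llrWeight_le_iff hprior hμ).2 hz)

theorem stopValue_llrWeight_of_ge (hprior : ∀ i, 0 < prior i) (hμ : ∀ i, 0 < μ i) {z : ℝ}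
    (hz : z ≤ Real.log (μ 0 * prior 0 / (μ 1 * prior 1))) :
    stopValue μ (llrWeight prior z) = μ 1 * (prior 1 * Real.exp z) := by
  refine min_eq_right ?_
  rcases hz.eq_or_lt with h | h
  · have h0 := mul_pos (hμ 0) (hprior 0)
    have h1 := mul_pos (hμ 1) (hprior 1)
    have : Real.exp z = μ 0 * prior 0 / (μ 1 * prior 1) := by
      rw [h, Real.exp_log (div_pos h0 h1)]
    simp only [llrWeight, Matrix.cons_val_zero, Matrix.cons_val_one]
    rw [this, ← mul_assoc, mul_div_cancel₀ _ h1.ne']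
  · exact (lt_of_not_ge fun h' => not_le.2 h ((mul_llrWeight_le_iff hprior hμ).1 h')).le

omit [MeasurableSpace 𝓧] in
/-- The update of the weights after a sample: the log-likelihood ratio of the sample is added. -/
theorem llrWeight_mul_eq {ℓ : Fin K} {x : 𝓧} (h0 : 0 < f 0 ℓ x) (h1 : 0 < f 1 ℓ x) (z : ℝ) :
    (fun i => llrWeight prior z i * f i ℓ x)
      = f 0 ℓ x • llrWeight prior (z + sampleLLR f ℓ x) := by
  ext i
  fin_cases i
  · simp [llrWeight, mul_comm]
  · simp only [llrWeight, sampleLLR, Real.exp_add, Real.exp_log (div_pos h1 h0)]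
    simp
    field_simp

/-- Division by zero and `Real.log 0` both give `0`, so a vanishing density forces the value `0`. -/
theorem pos_of_sampleLLR_ne_zero (hf : IsSensorFamily ν f) {ℓ : Fin K} {x : 𝓧}
    (h : sampleLLR f ℓ x ≠ 0) (i : Fin 2) : 0 < f i ℓ x := by
  refine (hf.nonneg i ℓ x).lt_of_ne' fun hi => h ?_
  revert i
  simp +contextual [Fin.forall_fin_two, sampleLLR]

/-- If `c` is already reached at `s`, the threshold degenerates to `s` and need not be a root; hence
the proviso `s < b`. -/
theorem exists_threshold {φ : ℝ → ℝ} (hφ : Continuous φ) (hmono : StrictMono φ) {s c : ℝ}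
    (hc : ∃ z, c ≤ φ z) :
    ∃ b, s ≤ b ∧ (∀ z, s ≤ z → (φ z < c ↔ z < b)) ∧ (s < b → φ b = c) := by
  by_cases hs : φ s < c
  · obtain ⟨z, hz⟩ := hc
    have hsz : s ≤ z := (hmono.lt_iff_lt.1 (hs.trans_le hz)).le
    obtain ⟨b, hb, rfl⟩ := intermediate_value_Icc hsz hφ.continuousOn ⟨hs.le, hz⟩
    exact ⟨b, hb.1, fun z _ => hmono.lt_iff_lt, fun _ => rfl⟩
  · refine ⟨s, le_rfl, fun z hz => ⟨fun h => ?_, fun h => absurd h hz.not_gt⟩,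
      fun h => absurd h (lt_irrefl _)⟩
    exact absurd ((hmono.monotone hz).trans_lt h) hs

variable [NeZero K]

theorem IsCostToGo.continueValue_llrWeight_strictMono (hU : IsCostToGo μ U)
    (hf : IsSensorFamily ν f) (hC : ∀ ℓ, 1 ≤ C ℓ) (hprior : ∀ i, 0 < prior i) :
    StrictMono fun z => continueValue ν f C U (llrWeight prior z) := fun _ _ h =>
  hU.continueValue_strictMono hC hf (llrWeight_nonneg hprior _) (llrWeight_mono hprior h.le)
    (mul_lt_mul_of_pos_left (Real.exp_lt_exp.2 h) (hprior 1))

/-- Monotonicity and homogeneity squeeze `φ z'` between `exp (-|z' - z|) * φ z` and `exp |z' - z| *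
φ z`; no limit is taken under the integral. -/
theorem IsCostToGo.continuous_continueValue_llrWeight (hU : IsCostToGo μ U)
    (hf : IsSensorFamily ν f) (hC : ∀ ℓ, 1 ≤ C ℓ) (hprior : ∀ i, 0 < prior i) :
    Continuous fun z => continueValue ν f C U (llrWeight prior z) := by
  set φ : ℝ → ℝ := fun z => continueValue ν f C U (llrWeight prior z) with hφ
  have hmono : StrictMono φ := hU.continueValue_llrWeight_strictMono hf hC hprior
  have hle : ∀ {z z'}, z ≤ z' → φ z' ≤ Real.exp (z' - z) * φ z := fun {z z'} h => by
    simp only [hφ]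
    rw [← hU.continueValue_smul (Real.exp_pos _).le]
    exact hU.continueValue_mono hC hf (llrWeight_nonneg hprior _) (llrWeight_le_smul hprior h)
  have hnn : ∀ z, 0 ≤ φ z := fun z =>
    (add_nonneg (llrWeight_nonneg hprior z 0) (llrWeight_nonneg hprior z 1)).trans
      (hU.le_continueValue hC hf (llrWeight_nonneg hprior z))
  refine continuous_iff_continuousAt.2 fun z => ?_
  have hup : ∀ z', φ z' ≤ Real.exp |z' - z| * φ z := fun z' => by
    rcases le_total z z' with h | h
    · rw [abs_of_nonneg (sub_nonneg.2 h)]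
      exact hle h
    · exact (hmono.monotone h).trans
        (le_mul_of_one_le_left (hnn z) (Real.one_le_exp (abs_nonneg _)))
  have hlo : ∀ z', Real.exp (-|z' - z|) * φ z ≤ φ z' := fun z' => by
    rw [Real.exp_neg, inv_mul_le_iff₀ (Real.exp_pos _)]
    rcases le_total z z' with h | h
    · exact (hmono.monotone h).trans
        (le_mul_of_one_le_left (hnn z') (Real.one_le_exp (abs_nonneg _)))
    · rw [abs_sub_comm, abs_of_nonneg (sub_nonneg.2 h)]
      exact hle h
  refine tendsto_of_tendsto_of_tendsto_of_le_of_le ?_ ?_ hlo hup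
  · have : Continuous fun z' => Real.exp (-|z' - z|) * φ z := by fun_prop
    simpa using this.tendsto z
  · have : Continuous fun z' => Real.exp |z' - z| * φ z := by fun_prop
    simpa using this.tendsto z

/-- The upper thresholds of the optimal procedure, indexed by the number of samples that may still
be taken. -/
theorem exists_upper_thresholds [SFinite ν] (hf : IsSensorFamily ν f) (hμ : ∀ i, 0 < μ i)
    (hC : ∀ ℓ, 1 ≤ C ℓ) (hprior : ∀ i, 0 < prior i) {s : ℝ}
    (hs : s = Real.log (μ 0 * prior 0 / (μ 1 * prior 1))) :
    ∃ β : ℕ → ℝ, β 0 = s ∧ (∀ m, s ≤ β m) ∧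
      (∀ m z, s ≤ z → (continueValue ν f C (value ν f μ C m) (llrWeight prior z)
        < stopValue μ (llrWeight prior z) ↔ z < β (m + 1))) ∧
      Monotone β ∧
      (continueValue ν f C (stopValue μ) (llrWeight prior s) < stopValue μ (llrWeight prior s) →
        (∀ ℓ, ∀ ε > 0, ν {x | -ε < sampleLLR f ℓ x ∧ sampleLLR f ℓ x < 0} ≠ 0) →
        StrictMono β) := by
  have hV := isCostToGo_value hf hμ hC
  set φ : ℕ → ℝ → ℝ := fun m z => continueValue ν f C (value ν f μ C m) (llrWeight prior z)
    with hφ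
  have hterm : ∀ {z}, s ≤ z → stopValue μ (llrWeight prior z) = μ 0 * prior 0 := fun h =>
    stopValue_llrWeight_of_le hprior hμ (hs ▸ h)
  have hub : ∀ m, ∃ z, μ 0 * prior 0 ≤ φ m z := fun m => by
    -- At this `z` the weight of hypothesis 1 is `μ 0 * prior 0`, so the sampling cost alone exceeds
    -- the stopping cost.
    refine ⟨Real.log (μ 0 * prior 0 / prior 1), ?_⟩
    refine le_trans ?_ ((hV m).le_continueValue hC hf (llrWeight_nonneg hprior _))
    have h := div_pos (mul_pos (hμ 0) (hprior 0)) (hprior 1)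
    simp only [llrWeight, Real.exp_log h, Matrix.cons_val_zero, Matrix.cons_val_one]
    rw [mul_div_cancel₀ _ (hprior 1).ne']
    linarith [hprior 0]
  choose b hsb hb hbroot using fun m => exists_threshold (s := s)
    ((hV m).continuous_continueValue_llrWeight hf hC hprior)
    ((hV m).continueValue_llrWeight_strictMono hf hC hprior) (hub m)
  -- The shift by one: `b m` concerns a sample after which `m` more may be taken, so `m + 1` are
  -- left before it.
  let β : ℕ → ℝ := fun m => m.casesOn s b
  have hsβ : ∀ m, s ≤ β m := fun m => by
    cases m
    · exact le_rfl
    · exact hsb _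
  have hanti : ∀ m z, φ (m + 1) z ≤ φ m z := fun m z =>
    continueValue_mono_costToGo (hV _) (hV _) hf (fun p hp => value_succ_le hf hμ hC m hp)
      (llrWeight_nonneg hprior z)
  refine ⟨β, rfl, hsβ, fun m z hz => by rw [hterm hz]; exact hb m z hz, ?_, fun h0 hpos => ?_⟩
  · refine monotone_nat_of_le_succ fun m => ?_
    cases m with
    | zero => exact hsb 0
    | succ m =>
      by_contra! hlt
      exact lt_irrefl _ ((hb (m + 1) _ (hsb _)).1
        ((hanti m _).trans_lt ((hb m _ (hsb _)).2 hlt)))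
  · refine strictMono_nat_of_lt_succ fun m => ?_
    induction m with
    | zero => exact (hb 0 s le_rfl).1 (by rw [← hterm le_rfl]; exact h0)
    | succ m ih =>
      -- Since `b m` exceeds `s`, it is a root of `φ m`. It suffices that `φ (m + 1)` is strictly
      -- smaller there, and the sensor optimal for `φ m` already shows this.
      have hsm : s < b m := (hsβ m).trans_lt ih
      refine (hb (m + 1) _ (hsb m)).1 (lt_of_lt_of_eq ?_ (hbroot m hsm))
      obtain ⟨ℓ, hℓ⟩ := exists_continueValue_eq (ν := ν) (f := f) (C := C)
        (U := value ν f μ C m) (llrWeight prior (b m))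
      rw [hℓ]
      refine (continueValue_le ℓ _).trans_lt (add_lt_add_right ?_ _)
      have hnn := llrWeight_nonneg hprior (b m)
      have hle : (fun x => value ν f μ C (m + 1) fun i => llrWeight prior (b m) i * f i ℓ x)
          ≤ fun x => value ν f μ C m fun i => llrWeight prior (b m) i * f i ℓ x :=
        fun x => value_succ_le hf hμ hC m (hf.mul_nonneg hnn ℓ x)
      have hi := (hV (m + 1)).integrable_update hf hnn ℓ
      have hi' := (hV m).integrable_update hf hnn ℓ
      -- Equal integrals would force the integrands to agree almost everywhere. They differ whenever
      -- the sample moves `b m` into `[β m, b m)`: there `m` remaining samples leave only the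
      -- stopping cost, while `m + 1` make continuing strictly better.
      refine (integral_mono hi hi' hle).lt_of_ne fun heq => ?_
      refine hpos ℓ (b m - β m) (sub_pos.2 ih) ?_
      have hae := (integral_eq_iff_of_ae_le hi hi' (ae_of_all _ hle)).1 heq
      refine measure_mono_null (fun x hx => ?_) hae
      have h0 := pos_of_sampleLLR_ne_zero hf hx.2.ne
      have hz : β m ≤ b m + sampleLLR f ℓ x := by linarith [hx.1]
      have hz' : b m + sampleLLR f ℓ x < b m := by linarith [hx.2]
      show ¬ _ = _
      simp only [llrWeight_mul_eq (h0 0) (h0 1), (hV _).smul _ _ (h0 0).le]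
      refine fun h => absurd (mul_left_cancel₀ (h0 0).ne' h) (ne_of_lt ?_)
      refine lt_of_lt_of_le (b := μ 0 * prior 0) ?_ ?_
      · exact (min_le_right _ _).trans_lt ((hb m _ ((hsβ m).trans hz)).2 hz')
      · cases m with
        | zero => exact (hterm hz).ge
        | succ m =>
          refine le_min (hterm ((hsβ (m + 1)).trans hz)).ge ?_
          by_contra! hlt
          exact absurd ((hb m _ ((hsβ (m + 1)).trans hz)).1 hlt) hz.not_gt

/-- The thresholds of the optimal procedure, indexed by the number of samples that may still be
taken. -/
theorem exists_thresholds [SFinite ν] (hf : IsSensorFamily ν f) (hμ : ∀ i, 0 < μ i)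
    (hC : ∀ ℓ, 1 ≤ C ℓ) (hprior : ∀ i, 0 < prior i) {s : ℝ}
    (hs : s = Real.log (μ 0 * prior 0 / (μ 1 * prior 1))) :
    ∃ α β : ℕ → ℝ, α 0 = -s ∧ β 0 = s ∧ (∀ m, -s ≤ α m) ∧ (∀ m, s ≤ β m) ∧
      (∀ m z, continueValue ν f C (value ν f μ C m) (llrWeight prior z)
        < stopValue μ (llrWeight prior z) ↔ z ∈ Ioo (-α (m + 1)) (β (m + 1))) ∧
      Monotone α ∧ Monotone β ∧
      (continueValue ν f C (stopValue μ) (llrWeight prior s) < stopValue μ (llrWeight prior s) →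
        (∀ ℓ, ∀ ε > 0, ν {x | 0 < sampleLLR f ℓ x ∧ sampleLLR f ℓ x < ε} ≠ 0 ∧
          ν {x | -ε < sampleLLR f ℓ x ∧ sampleLLR f ℓ x < 0} ≠ 0) →
        StrictMono α ∧ StrictMono β) := by
  have hs' : -s = Real.log ((fun i : Fin 2 => μ i.rev) 0 * (fun i : Fin 2 => prior i.rev) 0
      / ((fun i : Fin 2 => μ i.rev) 1 * (fun i : Fin 2 => prior i.rev) 1)) := by
    rw [hs, ← Real.log_inv, inv_div]
    rfl
  obtain ⟨β, hβ0, hsβ, hβ, hβm, hβs⟩ := exists_upper_thresholds hf hμ hC hprior hs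
  obtain ⟨α, hα0, hsα, hα, hαm, hαs⟩ := exists_upper_thresholds hf.rev (fun i => hμ i.rev) hC
    (fun i => hprior i.rev) hs'
  have hrev : ∀ (U U' : (Fin 2 → ℝ) → ℝ), IsCostToGo μ U → (∀ p, U' (fun i => p i.rev) = U p) →
      ∀ z, (continueValue ν f C U (llrWeight prior z) < stopValue μ (llrWeight prior z) ↔
      continueValue ν (fun i => f i.rev) C U' (llrWeight (fun i => prior i.rev) (-z))
        < stopValue (fun i => μ i.rev) (llrWeight (fun i => prior i.rev) (-z))) := by
    intro U U' hU h z
    rw [llrWeight_rev, hU.continueValue_smul (Real.exp_pos z).le,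
      (isCostToGo_stopValue hμ).smul _ _ (Real.exp_pos z).le,
      mul_lt_mul_iff_right₀ (Real.exp_pos z), ← continueValue_rev h, ← stopValue_rev]
    simp only [Fin.rev_rev]
  have hα' : ∀ m z, z ≤ s → (continueValue ν f C (value ν f μ C m) (llrWeight prior z)
        < stopValue μ (llrWeight prior z) ↔ -α (m + 1) < z) := fun m z hz => by
    rw [hrev _ _ (isCostToGo_value hf hμ hC m) (value_rev m), hα m _ (neg_le_neg hz), neg_lt]
  refine ⟨α, β, hα0, hβ0, hsα, hsβ, fun m z => ?_, hαm, hβm, fun h0 hpos => ⟨hαs ?_ ?_, hβs h0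
    fun ℓ ε hε => (hpos ℓ ε hε).2⟩⟩
  -- On either side of `s` only one threshold is active; the other bound is automatic from `-α ≤ s ≤
  -- β`.
  · rcases lt_trichotomy z s with h | rfl | h
    · rw [hα' m z h.le]
      exact ⟨fun h' => ⟨h', h.trans_le (hsβ _)⟩, fun h' => h'.1⟩
    · exact ⟨fun h' => ⟨(hα' m z le_rfl).1 h', (hβ m z le_rfl).1 h'⟩,
        fun h' => (hβ m z le_rfl).2 h'.2⟩
    · rw [hβ m z h.le]
      exact ⟨fun h' => ⟨(neg_le.1 (hsα _)).trans_lt h, h'⟩, fun h' => h'.2⟩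
  · exact (hrev _ _ (isCostToGo_stopValue hμ) stopValue_rev s).1 h0
  · intro ℓ ε hε h
    refine (hpos ℓ ε hε).1 (measure_mono_null (fun x hx => ?_) h)
    have : sampleLLR (fun i => f i.rev) ℓ x = -sampleLLR f ℓ x := by
      simp only [sampleLLR]
      rw [← Real.log_inv, inv_div]
      rfl
    simp only [mem_ofPred_eq, this] at hx ⊢
    constructor <;> linarith [hx.1, hx.2]

end SensorTest
-- Conditioning a procedure on its first sample.
namespace SensorTest

section Cons

variable {𝓧 : Type*} [MeasurableSpace 𝓧] {n : ℕ}

theorem measurable_finCons :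
    Measurable fun z : 𝓧 × (Fin n → 𝓧) => (Fin.cons z.1 z.2 : Fin (n + 1) → 𝓧) := by
  refine measurable_pi_lambda _ (Fin.cases ?_ fun t => ?_)
  · exact measurable_fst
  · exact (measurable_pi_apply t).comp measurable_snd

theorem lintegral_pi_finCons (ν : Measure 𝓧) [SigmaFinite ν] {F : (Fin (n + 1) → 𝓧) → ENNReal}
    (hF : Measurable F) :
    ∫⁻ x, F x ∂(Measure.pi fun _ => ν)
      = ∫⁻ x, ∫⁻ y, F (Fin.cons x y) ∂(Measure.pi fun _ => ν) ∂ν := by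
  have h := (measurePreserving_piFinSuccAbove (fun _ : Fin (n + 1) => ν) 0).symm
  rw [← h.lintegral_comp hF, lintegral_prod (fun z => F _) (hF.comp h.measurable).aemeasurable]
  simp [MeasurableEquiv.piFinSuccAbove, Fin.insertNthEquiv]

end Cons

variable {𝓧 : Type*} [MeasurableSpace 𝓧] {ν : Measure 𝓧} {K n : ℕ}
  {f : Fin 2 → Fin K → 𝓧 → ℝ} {μ : Fin 2 → ℝ} {C : Fin K → ℝ}

namespace Procedure

/-- The procedure that remains when the first sample is known to be `x`. -/
def tail (Q : Procedure K (n + 1) 𝓧) (x : 𝓧) : Procedure K n 𝓧 where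
  select t y := Q.select t.succ (Fin.cons x y)
  -- Truncated subtraction: the value is meaningful only when `Q` takes a first sample, which the
  -- cost recursions assume.
  time y := Q.time (Fin.cons x y) - 1
  decide y := Q.decide (Fin.cons x y)
  measurable_select t :=
    (Q.measurable_select t.succ).comp (measurable_finCons.comp measurable_prodMk_left)
  measurable_time := (measurable_from_top (f := fun k : ℕ => k - 1)).comp
    (Q.measurable_time.comp (measurable_finCons.comp measurable_prodMk_left))
  measurable_decide := Q.measurable_decide.comp (measurable_finCons.comp measurable_prodMk_left)
  time_le y := Nat.sub_le_of_le_add (Q.time_le _)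
  select_adapted t y y' h := Q.select_adapted _ _ _ <| by
    refine Fin.cases (fun _ => by simp) fun s hs => ?_
    simpa using h s (Fin.succ_lt_succ_iff.1 hs)
  time_adapted y y' h := by
    refine congrArg (· - 1) (Q.time_adapted _ _ ?_)
    refine Fin.cases (fun _ => by simp) fun s hs => ?_
    simpa using h s (Nat.lt_sub_of_add_lt (by simpa using hs))
  decide_adapted y y' h := by
    refine Q.decide_adapted _ _ ?_
    refine Fin.cases (fun _ => by simp) fun s hs => ?_
    simpa using h s (Nat.lt_sub_of_add_lt (by simpa using hs))

/-- The sampling cost and penalty on the sample path `x` under hypothesis `i`. -/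
noncomputable def pathCost (Q : Procedure K n 𝓧) (C : Fin K → ℝ) (μ : Fin 2 → ℝ) (i : Fin 2)
    (x : Fin n → 𝓧) : ℝ :=
  (∑ t ∈ Finset.univ.filter (fun t : Fin n => (t : ℕ) < Q.time x), C (Q.select t x))
    + if Q.decide x = i then 0 else μ i

/-- The density of the sample path under hypothesis `i`. -/
noncomputable def pathDensity (Q : Procedure K n 𝓧) (f : Fin 2 → Fin K → 𝓧 → ℝ) (i : Fin 2)
    (x : Fin n → 𝓧) : ℝ :=
  ∏ t, f i (Q.select t x) (x t)

/-- The risk under hypothesis `i`. -/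
noncomputable def condRisk (Q : Procedure K n 𝓧) (ν : Measure 𝓧) (f : Fin 2 → Fin K → 𝓧 → ℝ)
    (C : Fin K → ℝ) (μ : Fin 2 → ℝ) (i : Fin 2) : ENNReal :=
  ∫⁻ x, ENNReal.ofReal (Q.pathDensity f i x) * ENNReal.ofReal (Q.pathCost C μ i x)
    ∂(Measure.pi fun _ => ν)

theorem measurable_pathDensity (Q : Procedure K n 𝓧) (hf : IsSensorFamily ν f) (i : Fin 2) :
    Measurable (Q.pathDensity f i) := by
  refine Finset.measurable_prod _ fun t _ => ?_
  have h : Measurable fun z : Fin K × 𝓧 => f i z.1 z.2 :=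
    measurable_from_prod_countable_right fun ℓ => hf.measurable i ℓ
  exact h.comp ((Q.measurable_select t).prodMk (measurable_pi_apply t))

theorem measurable_pathCost (Q : Procedure K n 𝓧) (i : Fin 2) :
    Measurable (Q.pathCost C μ i) := by
  have h1 : Measurable fun x => ∑ t ∈ Finset.univ.filter (fun t : Fin n => (t : ℕ) < Q.time x),
      C (Q.select t x) := by
    simp only [Finset.sum_filter]
    refine Finset.measurable_sum _ fun t _ => Measurable.ite ?_ ?_ measurable_const
    · exact measurableSet_lt measurable_const Q.measurable_time
    · exact (measurable_from_top (f := C)).comp (Q.measurable_select t)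
  exact h1.add ((measurable_from_top (f := fun d : Fin 2 => if d = i then 0 else μ i)).comp
    Q.measurable_decide)

theorem pathCost_nonneg (Q : Procedure K n 𝓧) (hC : ∀ ℓ, 1 ≤ C ℓ) (hμ : ∀ i, 0 < μ i)
    (i : Fin 2) (x : Fin n → 𝓧) : 0 ≤ Q.pathCost C μ i x := by
  refine add_nonneg (Finset.sum_nonneg fun _ _ => zero_le_one.trans (hC _)) ?_
  split_ifs
  exacts [le_rfl, (hμ i).le]

theorem pathCost_le (Q : Procedure K n 𝓧) (hC : ∀ ℓ, 1 ≤ C ℓ) (hμ : ∀ i, 0 < μ i)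
    (i : Fin 2) (x : Fin n → 𝓧) : Q.pathCost C μ i x ≤ n * ∑ ℓ, C ℓ + μ i := by
  have h0 : ∀ ℓ, 0 ≤ C ℓ := fun ℓ => zero_le_one.trans (hC ℓ)
  refine add_le_add ?_ ?_
  · refine (Finset.sum_le_univ_sum_of_nonneg fun t => h0 _).trans ?_
    refine (Finset.sum_le_card_nsmul _ _ (∑ ℓ, C ℓ) fun t _ => ?_).trans (by simp)
    exact Finset.single_le_sum (fun ℓ _ => h0 ℓ) (Finset.mem_univ _)
  · split_ifs
    exacts [(hμ i).le, le_rfl]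

/-- The first selection depends on an empty past. -/
theorem exists_select_zero_eq [Nonempty 𝓧] (Q : Procedure K (n + 1) 𝓧) :
    ∃ ℓ, ∀ x, Q.select 0 x = ℓ :=
  ⟨Q.select 0 fun _ => Classical.arbitrary 𝓧, fun _ =>
    Q.select_adapted _ _ _ fun s hs => absurd hs (Fin.not_lt_zero s)⟩

theorem pathDensity_cons (Q : Procedure K (n + 1) 𝓧) {ℓ : Fin K} (hℓ : ∀ x, Q.select 0 x = ℓ)
    (i : Fin 2) (x : 𝓧) (y : Fin n → 𝓧) :
    Q.pathDensity f i (Fin.cons x y) = f i ℓ x * (Q.tail x).pathDensity f i y := by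
  simp [pathDensity, Fin.prod_univ_succ, hℓ, tail]

theorem pathCost_cons (Q : Procedure K (n + 1) 𝓧) {ℓ : Fin K} (hℓ : ∀ x, Q.select 0 x = ℓ)
    (h0 : ∀ x, Q.time x ≠ 0) (i : Fin 2) (x : 𝓧) (y : Fin n → 𝓧) :
    Q.pathCost C μ i (Fin.cons x y) = C ℓ + (Q.tail x).pathCost C μ i y := by
  simp [pathCost, Finset.sum_filter, Fin.sum_univ_succ, hℓ, tail, Nat.pos_of_ne_zero (h0 _),
    Nat.lt_sub_iff_add_lt, add_assoc]
  rfl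

theorem llr_zero (Q : Procedure K n 𝓧) (x : Fin n → 𝓧) : Q.llr f 0 x = 0 := by
  simp [llr]

theorem llr_cons (Q : Procedure K (n + 1) 𝓧) {ℓ : Fin K} (hℓ : ∀ x, Q.select 0 x = ℓ)
    (t : ℕ) (x : 𝓧) (y : Fin n → 𝓧) :
    Q.llr f (t + 1) (Fin.cons x y) = sampleLLR f ℓ x + (Q.tail x).llr f t y := by
  simp [llr, Finset.sum_filter, Fin.sum_univ_succ, hℓ, tail]

/-- Given the first sample, the remaining density is that of the tail procedure, so the later
coordinates integrate out to `1` by induction. -/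
theorem lintegral_pathDensity [SigmaFinite ν] [Nonempty 𝓧] (Q : Procedure K n 𝓧)
    (hf : IsSensorFamily ν f) (i : Fin 2) :
    ∫⁻ x, ENNReal.ofReal (Q.pathDensity f i x) ∂(Measure.pi fun _ => ν) = 1 := by
  induction n with
  | zero => simp [pathDensity]
  | succ n ih =>
    obtain ⟨ℓ, hℓ⟩ := Q.exists_select_zero_eq
    rw [lintegral_pi_finCons ν (Q.measurable_pathDensity hf i).ennreal_ofReal]
    simp only [Q.pathDensity_cons hℓ, ENNReal.ofReal_mul (hf.nonneg _ _ _)]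
    simp_rw [lintegral_const_mul' _ _ ENNReal.ofReal_ne_top, ih, mul_one]
    exact hf.lintegral_eq_one i ℓ

theorem condRisk_ne_top [SigmaFinite ν] [Nonempty 𝓧] (Q : Procedure K n 𝓧)
    (hf : IsSensorFamily ν f) (hC : ∀ ℓ, 1 ≤ C ℓ) (hμ : ∀ i, 0 < μ i) (i : Fin 2) :
    Q.condRisk ν f C μ i ≠ ⊤ := by
  refine ne_top_of_le_ne_top (b := 1 * ENNReal.ofReal (n * ∑ ℓ, C ℓ + μ i))
    (by simp) ?_
  rw [← Q.lintegral_pathDensity hf i, ← lintegral_mul_const' _ _ ENNReal.ofReal_ne_top]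
  exact lintegral_mono fun x => mul_le_mul_right
    (ENNReal.ofReal_le_ofReal (Q.pathCost_le hC hμ i x)) _

/-- A procedure that takes no sample always makes the same decision. -/
theorem condRisk_of_time_eq_zero [SigmaFinite ν] [Nonempty 𝓧] (Q : Procedure K n 𝓧)
    (hf : IsSensorFamily ν f) {x₀ : Fin n → 𝓧} (h0 : Q.time x₀ = 0) (i : Fin 2) :
    Q.condRisk ν f C μ i = ENNReal.ofReal (if Q.decide x₀ = i then 0 else μ i) := by
  have h : ∀ x, Q.pathCost C μ i x = if Q.decide x₀ = i then 0 else μ i := fun x => by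
    have ht : Q.time x₀ = Q.time x := Q.time_adapted _ _ fun s hs => by simp [h0] at hs
    have hd : Q.decide x₀ = Q.decide x := Q.decide_adapted _ _ fun s hs => by simp [h0] at hs
    simp [pathCost, ← ht, ← hd, h0]
  simp only [condRisk, h]
  rw [lintegral_mul_const' _ _ ENNReal.ofReal_ne_top, Q.lintegral_pathDensity hf, one_mul]

theorem measurable_condRisk_tail [SigmaFinite ν] (Q : Procedure K (n + 1) 𝓧)
    (hf : IsSensorFamily ν f) (i : Fin 2) :
    Measurable fun x => (Q.tail x).condRisk ν f C μ i := by
  have hd : Measurable fun z : 𝓧 × (Fin n → 𝓧) => (Q.tail z.1).pathDensity f i z.2 := by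
    refine Finset.measurable_prod _ fun t _ => ?_
    have h : Measurable fun z : Fin K × 𝓧 => f i z.1 z.2 :=
      measurable_from_prod_countable_right fun ℓ => hf.measurable i ℓ
    exact h.comp (((Q.measurable_select t.succ).comp measurable_finCons).prodMk
      ((measurable_pi_apply t).comp measurable_snd))
  have hc : Measurable fun z : 𝓧 × (Fin n → 𝓧) => (Q.tail z.1).pathCost C μ i z.2 := by
    have h1 : Measurable fun z : 𝓧 × (Fin n → 𝓧) =>
        ∑ t ∈ Finset.univ.filter (fun t : Fin n => (t : ℕ) < (Q.tail z.1).time z.2),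
          C ((Q.tail z.1).select t z.2) := by
      simp only [Finset.sum_filter]
      refine Finset.measurable_sum _ fun t _ => Measurable.ite ?_ ?_ measurable_const
      · exact measurableSet_lt measurable_const
          ((measurable_from_top (f := fun k : ℕ => k - 1)).comp (Q.measurable_time.comp measurable_finCons))
      · exact (measurable_from_top (f := C)).comp
          ((Q.measurable_select t.succ).comp measurable_finCons)
    exact h1.add ((measurable_from_top (f := fun d : Fin 2 => if d = i then 0 else μ i)).comp
      (Q.measurable_decide.comp measurable_finCons))
  exact (hd.ennreal_ofReal.mul hc.ennreal_ofReal).lintegral_prod_right'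

/-- Conditioning on the first sample. -/
theorem condRisk_succ [SigmaFinite ν] [Nonempty 𝓧] (Q : Procedure K (n + 1) 𝓧)
    (hf : IsSensorFamily ν f) (hC : ∀ ℓ, 1 ≤ C ℓ) (hμ : ∀ i, 0 < μ i)
    {ℓ : Fin K} (hℓ : ∀ x, Q.select 0 x = ℓ) (h0 : ∀ x, Q.time x ≠ 0) (i : Fin 2) :
    Q.condRisk ν f C μ i = ENNReal.ofReal (C ℓ)
      + ∫⁻ x, ENNReal.ofReal (f i ℓ x) * (Q.tail x).condRisk ν f C μ i ∂ν := by
  have hm : Measurable fun x => ENNReal.ofReal (f i ℓ x) * ENNReal.ofReal (C ℓ) :=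
    (hf.measurable i ℓ).ennreal_ofReal.mul_const _
  have hF : Measurable fun x => ENNReal.ofReal (Q.pathDensity f i x)
      * ENNReal.ofReal (Q.pathCost C μ i x) :=
    (Q.measurable_pathDensity hf i).ennreal_ofReal.mul (Q.measurable_pathCost i).ennreal_ofReal
  rw [condRisk, lintegral_pi_finCons ν hF]
  calc _ = ∫⁻ x, (ENNReal.ofReal (f i ℓ x) * ENNReal.ofReal (C ℓ)
        + ENNReal.ofReal (f i ℓ x) * (Q.tail x).condRisk ν f C μ i) ∂ν := by
        refine lintegral_congr fun x => ?_
        simp only [Q.pathDensity_cons hℓ, Q.pathCost_cons hℓ h0,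
          ENNReal.ofReal_mul (hf.nonneg _ _ _),
          ENNReal.ofReal_add (zero_le_one.trans (hC ℓ)) (pathCost_nonneg _ hC hμ _ _),
          mul_assoc, mul_add]
        rw [lintegral_add_left, lintegral_const_mul' _ _ ENNReal.ofReal_ne_top,
          lintegral_const_mul' _ _ ENNReal.ofReal_ne_top,
          lintegral_mul_const' _ _ ENNReal.ofReal_ne_top,
          (Q.tail x).lintegral_pathDensity hf, one_mul, condRisk]
        exact ((((Q.tail x).measurable_pathDensity hf i).ennreal_ofReal).mul_const _).const_mul _
    _ = _ := by
        rw [lintegral_add_left hm, lintegral_mul_const' _ _ ENNReal.ofReal_ne_top,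
          hf.lintegral_eq_one, one_mul]

/-- The risk when hypothesis `i` has weight `p i`. -/
noncomputable def weightedRisk (Q : Procedure K n 𝓧) (ν : Measure 𝓧)
    (f : Fin 2 → Fin K → 𝓧 → ℝ) (C : Fin K → ℝ) (μ p : Fin 2 → ℝ) : ENNReal :=
  ENNReal.ofReal (p 0) * Q.condRisk ν f C μ 0 + ENNReal.ofReal (p 1) * Q.condRisk ν f C μ 1

theorem weightedRisk_of_time_eq_zero [SigmaFinite ν] [Nonempty 𝓧] (Q : Procedure K n 𝓧)
    (hf : IsSensorFamily ν f) {p : Fin 2 → ℝ} (hp : 0 ≤ p)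
    {x₀ : Fin n → 𝓧} (h0 : Q.time x₀ = 0) :
    Q.weightedRisk ν f C μ p
      = ENNReal.ofReal (if Q.decide x₀ = 1 then μ 0 * p 0 else μ 1 * p 1) := by
  rw [weightedRisk, Q.condRisk_of_time_eq_zero hf h0, Q.condRisk_of_time_eq_zero hf h0]
  generalize Q.decide x₀ = d
  fin_cases d <;> simp [← ENNReal.ofReal_mul (hp _), mul_comm]

theorem weightedRisk_succ [SigmaFinite ν] [Nonempty 𝓧] (Q : Procedure K (n + 1) 𝓧)
    (hf : IsSensorFamily ν f) (hC : ∀ ℓ, 1 ≤ C ℓ) (hμ : ∀ i, 0 < μ i)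
    {p : Fin 2 → ℝ} (hp : 0 ≤ p)
    {ℓ : Fin K} (hℓ : ∀ x, Q.select 0 x = ℓ) (h0 : ∀ x, Q.time x ≠ 0) :
    Q.weightedRisk ν f C μ p = ENNReal.ofReal (C ℓ * (p 0 + p 1))
      + ∫⁻ x, (Q.tail x).weightedRisk ν f C μ (fun i => p i * f i ℓ x) ∂ν := by
  have hm : ∀ i, Measurable fun x => ENNReal.ofReal (f i ℓ x) * (Q.tail x).condRisk ν f C μ i :=
    fun i => (hf.measurable i ℓ).ennreal_ofReal.mul (Q.measurable_condRisk_tail hf i)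
  simp only [weightedRisk, ENNReal.ofReal_mul (hp _), mul_assoc]
  rw [lintegral_add_left ((hm 0).const_mul _), lintegral_const_mul' _ _ ENNReal.ofReal_ne_top,
    lintegral_const_mul' _ _ ENNReal.ofReal_ne_top, Q.condRisk_succ hf hC hμ hℓ h0,
    Q.condRisk_succ hf hC hμ hℓ h0, ENNReal.ofReal_mul (zero_le_one.trans (hC ℓ)),
    ENNReal.ofReal_add (hp 0) (hp 1)]
  ring

end Procedure

/-! ### Verification: the value function is a lower bound, attained by threshold procedures. -/

theorem ofReal_sampleValue [SigmaFinite ν] (hf : IsSensorFamily ν f) (hC : ∀ ℓ, 1 ≤ C ℓ)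
    {U : (Fin 2 → ℝ) → ℝ} (hU : IsCostToGo μ U) {p : Fin 2 → ℝ} (hp : 0 ≤ p) (ℓ : Fin K) :
    ENNReal.ofReal (sampleValue ν f C U ℓ p) = ENNReal.ofReal (C ℓ * (p 0 + p 1))
      + ∫⁻ x, ENNReal.ofReal (U fun i => p i * f i ℓ x) ∂ν := by
  have hnn : ∀ x, 0 ≤ U fun i => p i * f i ℓ x := fun x => hU.nonneg _ (hf.mul_nonneg hp ℓ x)
  rw [sampleValue, ENNReal.ofReal_add
    (mul_nonneg (zero_le_one.trans (hC ℓ)) (add_nonneg (hp 0) (hp 1))) (integral_nonneg hnn),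
    ofReal_integral_eq_lintegral_ofReal (hU.integrable_update hf hp ℓ) (ae_of_all _ hnn)]

/-- `Q` is a threshold procedure started at log-likelihood ratio `z`; the selection rule `σ` and
the thresholds `α`, `β` are indexed by the number of samples that may still be taken. -/
structure Procedure.IsThreshold (Q : Procedure K n 𝓧) (f : Fin 2 → Fin K → 𝓧 → ℝ)
    (σ : ℕ → ℝ → Fin K) (α β : ℕ → ℝ) (z : ℝ) : Prop where
  select_eq : ∀ (t : Fin n) x, Q.select t x = σ (n - t) (z + Q.llr f t x)
  isLeast_time : ∀ x, IsLeast {t : ℕ | z + Q.llr f t x ∉ Ioo (-α (n - t)) (β (n - t))} (Q.time x)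
  decide_eq_zero : ∀ x, z + Q.llr f (Q.time x) x ≤ -α (n - Q.time x) →
    z + Q.llr f (Q.time x) x < β (n - Q.time x) → Q.decide x = 0
  decide_eq_one : ∀ x, β (n - Q.time x) ≤ z + Q.llr f (Q.time x) x → Q.decide x = 1

theorem Procedure.IsThreshold.tail {Q : Procedure K (n + 1) 𝓧} {σ : ℕ → ℝ → Fin K}
    {α β : ℕ → ℝ} {z : ℝ} (hQ : Q.IsThreshold f σ α β z) {ℓ : Fin K}
    (hℓ : ∀ x, Q.select 0 x = ℓ) (h0 : ∀ x, Q.time x ≠ 0) (x : 𝓧) :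
    (Q.tail x).IsThreshold f σ α β (z + sampleLLR f ℓ x) := by
  have hllr : ∀ t y, z + sampleLLR f ℓ x + (Q.tail x).llr f t y
      = z + Q.llr f (t + 1) (Fin.cons x y) := fun t y => by
    rw [Q.llr_cons hℓ, add_assoc]
  have hsub : ∀ t, n - t = n + 1 - (t + 1) := fun t => (Nat.add_sub_add_right n 1 t).symm
  have ht : ∀ y, (Q.tail x).time y + 1 = Q.time (Fin.cons x y) := fun y =>
    Nat.sub_add_cancel (Nat.pos_of_ne_zero (h0 _))
  refine ⟨fun t y => ?_, fun y => ?_, fun y => ?_, fun y => ?_⟩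
  · rw [hllr, hsub]
    exact hQ.select_eq t.succ (Fin.cons x y)
  · simp only [hllr, hsub]
    obtain ⟨h1, h2⟩ := hQ.isLeast_time (Fin.cons x y)
    rw [← ht] at h1 h2
    exact ⟨h1, fun t h => Nat.le_of_succ_le_succ (h2 h)⟩
  · rw [hllr, hsub, ht]
    exact hQ.decide_eq_zero _
  · rw [hllr, hsub, ht]
    exact hQ.decide_eq_one _

variable [NeZero K]

/-- No procedure beats the value function. -/
theorem value_le_weightedRisk [SigmaFinite ν] [Nonempty 𝓧] (hf : IsSensorFamily ν f)
    (hC : ∀ ℓ, 1 ≤ C ℓ) (hμ : ∀ i, 0 < μ i) (Q : Procedure K n 𝓧) {p : Fin 2 → ℝ} (hp : 0 ≤ p) :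
    ENNReal.ofReal (value ν f μ C n p) ≤ Q.weightedRisk ν f C μ p := by
  have hV := isCostToGo_value hf hμ hC
  induction n generalizing p with
  | zero =>
    rw [Q.weightedRisk_of_time_eq_zero hf hp (Nat.le_zero.1 (Q.time_le default))]
    refine ENNReal.ofReal_le_ofReal ?_
    split_ifs
    exacts [min_le_left _ _, min_le_right _ _]
  | succ n ih =>
    -- Stopping at time `0` is decided without data, so it happens on every path or on none.
    by_cases h0 : ∃ x, Q.time x = 0
    · obtain ⟨x, hx⟩ := h0
      rw [Q.weightedRisk_of_time_eq_zero hf hp hx]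
      refine ENNReal.ofReal_le_ofReal (((hV _).le_stopValue p hp).trans ?_)
      split_ifs
      exacts [min_le_left _ _, min_le_right _ _]
    · push Not at h0
      obtain ⟨ℓ, hℓ⟩ := Q.exists_select_zero_eq
      rw [Q.weightedRisk_succ hf hC hμ hp hℓ h0]
      refine (ENNReal.ofReal_le_ofReal ((min_le_right _ _).trans (continueValue_le ℓ p))).trans ?_
      rw [ofReal_sampleValue hf hC (hV n) hp]
      exact add_le_add_right (lintegral_mono fun x => ih (Q.tail x) (hf.mul_nonneg hp ℓ x)) _

/-- A threshold procedure whose selections and thresholds minimise the cost to go attains the value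
function. -/
theorem Procedure.IsThreshold.weightedRisk_eq [SigmaFinite ν] [Nonempty 𝓧]
    (hf : IsSensorFamily ν f)
    (hC : ∀ ℓ, 1 ≤ C ℓ) (hμ : ∀ i, 0 < μ i) {prior : Fin 2 → ℝ} (hprior : ∀ i, 0 < prior i)
    {σ : ℕ → ℝ → Fin K} {α β : ℕ → ℝ} {s : ℝ}
    (hs : s = Real.log (μ 0 * prior 0 / (μ 1 * prior 1)))
    (hα : ∀ m, -s ≤ α m) (hβ : ∀ m, s ≤ β m)
    (hσ : ∀ m z ℓ, sampleValue ν f C (value ν f μ C m) (σ (m + 1) z) (llrWeight prior z)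
      ≤ sampleValue ν f C (value ν f μ C m) ℓ (llrWeight prior z))
    (hαβ : ∀ m z, continueValue ν f C (value ν f μ C m) (llrWeight prior z)
        < stopValue μ (llrWeight prior z) ↔ z ∈ Ioo (-α (m + 1)) (β (m + 1)))
    {Q : Procedure K n 𝓧} {z : ℝ} (hQ : Q.IsThreshold f σ α β z) {c : ℝ} (hc : 0 ≤ c) :
    Q.weightedRisk ν f C μ (c • llrWeight prior z)
      = ENNReal.ofReal (value ν f μ C n (c • llrWeight prior z)) := by
  have hV := isCostToGo_value hf hμ hC
  have hnn : ∀ {c : ℝ} {z}, 0 ≤ c → 0 ≤ c • llrWeight prior z := fun hc =>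
    smul_nonneg hc (llrWeight_nonneg hprior _)
  have hterm : ∀ {n} {Q : Procedure K n 𝓧} {z c : ℝ}, Q.IsThreshold f σ α β z → 0 ≤ c →
      ∀ x, Q.time x = 0 → Q.weightedRisk ν f C μ (c • llrWeight prior z)
        = ENNReal.ofReal (stopValue μ (c • llrWeight prior z)) := by
    intro n Q z c hQ hc x hx
    rw [Q.weightedRisk_of_time_eq_zero hf (hnn hc) hx,
      (isCostToGo_stopValue hμ).smul _ _ hc]
    congr 1
    have h1 := (hQ.isLeast_time x).1
    have h2 := hQ.decide_eq_zero x
    have h3 := hQ.decide_eq_one x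
    simp only [hx, Q.llr_zero, Nat.sub_zero, add_zero, mem_ofPred_eq, mem_Ioo, not_and,
      not_lt] at h1 h2 h3
    -- Outside the interval, `z` is either at least `β n ≥ s` or at most `-α n ≤ s`, and the
    -- prescribed decision is the cheaper one on that side.
    by_cases hz : β n ≤ z
    · rw [if_pos (h3 hz), stopValue_llrWeight_of_le hprior hμ (hs ▸ (hβ n).trans hz)]
      simp [llrWeight]
      ring
    · have hz' : z ≤ -α n := by
        by_contra! h
        exact hz (h1 h)
      rw [h2 hz' (not_le.1 hz), if_neg (by decide), stopValue_llrWeight_of_ge hprior hμ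
        (hs ▸ hz'.trans (neg_le.1 (hα n)))]
      simp [llrWeight]
      ring
  -- The factor `c` must vary because a sample multiplies it by `f 0 ℓ x`; it may become `0`.
  induction n generalizing z c with
  | zero => exact hterm hQ hc default (Nat.le_zero.1 (Q.time_le default))
  | succ n ih =>
    have hcont : ∀ x, Q.time x = 0 ↔ z ∉ Ioo (-α (n + 1)) (β (n + 1)) := fun x => by
      obtain ⟨h1, h2⟩ := hQ.isLeast_time x
      constructor
      · intro h
        simpa [h, Q.llr_zero] using h1
      · intro h
        exact Nat.le_zero.1 (h2 (show _ ∉ _ by simpa [Q.llr_zero] using h))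
    simp only [value]
    by_cases hz : z ∈ Ioo (-α (n + 1)) (β (n + 1))
    · obtain ⟨ℓ, hℓ⟩ := Q.exists_select_zero_eq
      have h0 : ∀ x, Q.time x ≠ 0 := fun x h => (hcont x).1 h hz
      have hℓσ : ℓ = σ (n + 1) z := by
        rw [← hℓ fun _ => Classical.arbitrary 𝓧, hQ.select_eq]
        simp [Q.llr_zero]
      have hmin : continueValue ν f C (value ν f μ C n) (llrWeight prior z)
          = sampleValue ν f C (value ν f μ C n) ℓ (llrWeight prior z) := by
        obtain ⟨ℓ', h'⟩ := exists_continueValue_eq (ν := ν) (f := f) (C := C)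
          (U := value ν f μ C n) (llrWeight prior z)
        exact le_antisymm (continueValue_le _ _) (h' ▸ hℓσ ▸ hσ n z ℓ')
      rw [(isCostToGo_stopValue hμ).smul _ _ hc, (hV n).continueValue_smul hc,
        ← mul_min_of_nonneg _ _ hc, min_eq_right ((hαβ n z).2 hz).le, hmin,
        ← (hV n).sampleValue_smul ℓ hc, ofReal_sampleValue hf hC (hV n) (hnn hc),
        Q.weightedRisk_succ hf hC hμ (hnn hc) hℓ h0]
      congr 1
      refine lintegral_congr_ae ((hf.zero_iff ℓ).mono fun x hx => ?_)
      have hw : (fun i => (c • llrWeight prior z) i * f i ℓ x)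
          = (c * f 0 ℓ x) • llrWeight prior (z + sampleLLR f ℓ x) := by
        by_cases h : f 0 ℓ x = 0
        · have h' := hx.1 h
          ext i
          fin_cases i <;> simp [h, h']
        · have h0 := (hf.nonneg 0 ℓ x).lt_of_ne' h
          have h1 := (hf.nonneg 1 ℓ x).lt_of_ne' (mt hx.2 h)
          rw [mul_smul, ← llrWeight_mul_eq h0 h1]
          ext i
          simp [mul_assoc]
      simp only [hw]
      exact ih (hQ.tail hℓ h0 x) (mul_nonneg hc (hf.nonneg 0 ℓ x))
    · have x : Fin (n + 1) → 𝓧 := fun _ => Classical.arbitrary 𝓧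
      rw [hterm hQ hc x ((hcont x).2 hz)]
      congr 1
      rw [(isCostToGo_stopValue hμ).smul _ _ hc, (hV n).continueValue_smul hc,
        ← mul_min_of_nonneg _ _ hc, min_eq_left (not_lt.1 fun h => hz ((hαβ n z).1 h))]

end SensorTest
-- Construction of the threshold procedure.
namespace SensorTest

theorem exists_measurable_argmin {Z : Type*} [MeasurableSpace Z] {K : ℕ} [NeZero K]
    {q : Fin K → Z → ℝ} (hq : ∀ ℓ, Measurable (q ℓ)) :
    ∃ σ : Z → Fin K, Measurable σ ∧ ∀ z ℓ, q (σ z) z ≤ q ℓ z := by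
  suffices h : ∀ s : Finset (Fin K), ∃ σ : Z → Fin K, Measurable σ ∧
      ∀ z, ∀ ℓ ∈ s, q (σ z) z ≤ q ℓ z by
    obtain ⟨σ, h1, h2⟩ := h Finset.univ
    exact ⟨σ, h1, fun z ℓ => h2 z ℓ (Finset.mem_univ ℓ)⟩
  classical
  intro s
  induction s using Finset.induction_on with
  | empty => exact ⟨fun _ => 0, measurable_const, by simp⟩
  | insert a s _ ih =>
    obtain ⟨σ, h1, h2⟩ := ih
    have hm : Measurable fun z => q (σ z) z := by
      have h : Measurable fun y : Fin K × Z => q y.1 y.2 :=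
        measurable_from_prod_countable_right hq
      exact h.comp (h1.prodMk measurable_id)
    refine ⟨fun z => if q a z ≤ q (σ z) z then a else σ z,
      Measurable.ite (measurableSet_le (hq a) hm) measurable_const h1, fun z ℓ hℓ => ?_⟩
    rcases Finset.mem_insert.1 hℓ with rfl | hℓ
    · dsimp only
      split_ifs with h
      exacts [le_rfl, (not_le.1 h).le]
    · dsimp only
      split_ifs with h
      exacts [h.trans (h2 z ℓ hℓ), h2 z ℓ hℓ]

section Threshold

variable {𝓧 : Type*} {K N : ℕ} {f : Fin 2 → Fin K → 𝓧 → ℝ} {σ : ℕ → ℝ → Fin K} {α β : ℕ → ℝ}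

/-- The log-likelihood ratio after `t` samples when the sensors are selected by `σ`. -/
noncomputable def selectedLLR (f : Fin 2 → Fin K → 𝓧 → ℝ) (σ : ℕ → ℝ → Fin K) :
    ℕ → (Fin N → 𝓧) → ℝ
  | 0, _ => 0
  | t + 1, x => selectedLLR f σ t x
      + if h : t < N then sampleLLR f (σ (N - t) (selectedLLR f σ t x)) (x ⟨t, h⟩) else 0

theorem selectedLLR_congr {t : ℕ} {x y : Fin N → 𝓧} (h : ∀ s : Fin N, (s : ℕ) < t → x s = y s) :
    selectedLLR f σ t x = selectedLLR f σ t y := by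
  induction t with
  | zero => rfl
  | succ t ih =>
    have ih := ih fun s hs => h s (hs.trans t.lt_succ_self)
    simp only [selectedLLR, ih]
    split_ifs with ht
    · rw [h ⟨t, ht⟩ t.lt_succ_self]
    · rfl

/-- Selections depend on the log-likelihood ratio and conversely. The recursion `selectedLLR` breaks
this circle; here it is identified with the sum that defines `Procedure.llr`. -/
theorem sum_sampleLLR_eq_selectedLLR (t : ℕ) (x : Fin N → 𝓧) :
    ∑ s ∈ Finset.univ.filter (fun s : Fin N => (s : ℕ) < t),
      sampleLLR f (σ (N - s) (selectedLLR f σ s x)) (x s) = selectedLLR f σ t x := by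
  induction t with
  | zero => simp [selectedLLR]
  | succ t ih =>
    rw [selectedLLR]
    split_ifs with ht
    · have : Finset.univ.filter (fun s : Fin N => (s : ℕ) < t + 1)
          = insert ⟨t, ht⟩ (Finset.univ.filter fun s : Fin N => (s : ℕ) < t) := by
        ext s
        simp only [Finset.mem_filter, Finset.mem_univ, true_and, Finset.mem_insert, Fin.ext_iff]
        omega
      rw [this, Finset.sum_insert (by simp), add_comm, ih]
    · rw [add_zero, ← ih]
      congr 1
      ext s
      simp only [Finset.mem_filter, Finset.mem_univ, true_and]
      have := s.isLt
      omega

theorem measurable_selectedLLR [MeasurableSpace 𝓧] (hf : ∀ i ℓ, Measurable (f i ℓ))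
    (hσ : ∀ m, Measurable (σ m)) (t : ℕ) :
    Measurable (selectedLLR (N := N) f σ t) := by
  induction t with
  | zero => exact measurable_const
  | succ t ih =>
    refine ih.add ?_
    split_ifs with ht
    · have h : Measurable fun z : Fin K × 𝓧 => sampleLLR f z.1 z.2 :=
        measurable_from_prod_countable_right fun ℓ => ((hf 1 ℓ).div (hf 0 ℓ)).log
      exact h.comp (((hσ _).comp ih).prodMk (measurable_pi_apply _))
    · exact measurable_const

theorem exists_isThreshold [MeasurableSpace 𝓧] (hf : ∀ i ℓ, Measurable (f i ℓ))
    (hσ : ∀ m, Measurable (σ m)) (h0 : Ioo (-α 0) (β 0) = ∅) :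
    ∃ P : Procedure K N 𝓧, P.IsThreshold f σ α β 0 := by
  classical
  let L : ℕ → (Fin N → 𝓧) → ℝ := selectedLLR f σ
  have hL : ∀ t, Measurable (L t) := measurable_selectedLLR hf hσ
  -- With no sample left the interval is empty, which enforces the truncation at `N`.
  have hterm : ∀ x, L N x ∉ Ioo (-α (N - N)) (β (N - N)) := fun x => by
    rw [Nat.sub_self, h0]
    exact notMem_empty _
  have hex : ∀ x, ∃ t, L t x ∉ Ioo (-α (N - t)) (β (N - t)) := fun x => ⟨N, hterm x⟩
  let T : (Fin N → 𝓧) → ℕ := fun x => Nat.find (hex x)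
  have hT : Measurable T := measurable_find hex fun t => (hL t measurableSet_Ioo).compl
  have hTle : ∀ x, T x ≤ N := fun x => Nat.find_min' _ (hterm x)
  have hTad : ∀ x y : Fin N → 𝓧, (∀ s : Fin N, (s : ℕ) < T x → x s = y s) → T x = T y := by
    intro x y h
    refine ((Nat.find_eq_iff (hex y)).2 ⟨?_, fun t ht => ?_⟩).symm
    · rw [← show L (T x) x = L (T x) y from selectedLLR_congr h]
      exact Nat.find_spec (hex x)
    · rw [← show L t x = L t y from selectedLLR_congr fun s hs => h s (hs.trans ht)]
      exact Nat.find_min (hex x) ht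
  let D : (Fin N → 𝓧) → Fin 2 := fun x => if β (N - T x) ≤ L (T x) x then 1 else 0
  have hD : Measurable D := by
    refine Measurable.ite (measurableSet_le ((measurable_from_top
      (f := fun k : ℕ => β (N - k))).comp hT) ?_) measurable_const measurable_const
    have h : Measurable fun z : ℕ × (Fin N → 𝓧) => L z.1 z.2 :=
      measurable_from_prod_countable_right hL
    exact h.comp (hT.prodMk measurable_id)
  let P : Procedure K N 𝓧 :=
    { select := fun t x => σ (N - t) (L t x)
      time := T
      decide := D
      measurable_select := fun t => (hσ _).comp (hL t)
      measurable_time := hT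
      measurable_decide := hD
      time_le := hTle
      select_adapted := fun t x y h => by
        rw [show L t x = L t y from selectedLLR_congr h]
      time_adapted := hTad
      decide_adapted := fun x y h => by
        simp only [D, ← hTad x y h]
        rw [show L (T x) x = L (T x) y from selectedLLR_congr h] }
  have hllr : ∀ t x, 0 + P.llr f t x = L t x := fun t x => by
    rw [zero_add]
    exact sum_sampleLLR_eq_selectedLLR t x
  refine ⟨P, fun t x => by rw [hllr], fun x => ?_, fun x => ?_, fun x => ?_⟩
  · simp only [hllr]
    exact ⟨Nat.find_spec (hex x), fun t ht => Nat.find_min' (hex x) ht⟩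
  · rw [hllr]
    exact fun _ h => if_neg (not_le.2 h)
  · rw [hllr]
    exact fun h => if_pos h

end Threshold

/-! ### The Bayes risk, the total variation condition and the conclusion. -/

variable {𝓧 : Type*} [MeasurableSpace 𝓧] {ν : Measure 𝓧} {K N : ℕ}
  {f : Fin 2 → Fin K → 𝓧 → ℝ} {μ prior : Fin 2 → ℝ} {Ω : Finset (Fin K)} {lam : Fin K → ℝ}

theorem one_le_sampleCost (hlam : ∀ ℓ ∈ Ω, 0 ≤ lam ℓ) (ℓ : Fin K) : 1 ≤ sampleCost Ω lam ℓ := by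
  unfold sampleCost
  split_ifs with h
  · linarith [hlam ℓ h]
  · simp

theorem Procedure.risk_eq [SigmaFinite ν] [Nonempty 𝓧] (P : Procedure K N 𝓧)
    (hf : IsSensorFamily ν f) (hprior : ∀ i, 0 < prior i) (hμ : ∀ i, 0 < μ i)
    (hlam : ∀ ℓ ∈ Ω, 0 ≤ lam ℓ) :
    P.risk ν f prior μ Ω lam = (P.weightedRisk ν f (sampleCost Ω lam) μ prior).toReal := by
  have hC := one_le_sampleCost hlam
  have h : ∀ i, ∫ x, P.pathCost (sampleCost Ω lam) μ i x ∂(P.pathLaw ν f i)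
      = (P.condRisk ν f (sampleCost Ω lam) μ i).toReal := fun i => by
    have hm : Measurable (P.pathCost (sampleCost Ω lam) μ i) := P.measurable_pathCost i
    rw [integral_eq_lintegral_of_nonneg_ae (ae_of_all _ (P.pathCost_nonneg hC hμ i))
      hm.aestronglyMeasurable, pathLaw]
    congr 1
    exact lintegral_withDensity_eq_lintegral_mul _ (P.measurable_pathDensity hf i).ennreal_ofReal
      hm.ennreal_ofReal
  have ht := P.condRisk_ne_top hf hC hμ
  rw [weightedRisk, ENNReal.toReal_add (ENNReal.mul_ne_top ENNReal.ofReal_ne_top (ht 0))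
    (ENNReal.mul_ne_top ENNReal.ofReal_ne_top (ht 1)), ENNReal.toReal_mul, ENNReal.toReal_mul,
    ENNReal.toReal_ofReal (hprior 0).le, ENNReal.toReal_ofReal (hprior 1).le, ← h, ← h]
  exact Fin.sum_univ_two _

/-- The expected penalty after one sample taken at equal penalties is governed by the total
variation distance. -/
theorem integral_stopValue_eq (hf : IsSensorFamily ν f) {p : Fin 2 → ℝ} {c : ℝ} (hc : 0 ≤ c)
    (h0 : μ 0 * p 0 = c) (h1 : μ 1 * p 1 = c) (ℓ : Fin K) :
    ∫ x, stopValue μ (fun i => p i * f i ℓ x) ∂ν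
      = c * (1 - 1 / 2 * ∫ x, |f 1 ℓ x - f 0 ℓ x| ∂ν) := by
  -- This is `min a b = (a + b - |b - a|) / 2`.
  have h : ∀ x, stopValue μ (fun i => p i * f i ℓ x)
      = c / 2 * ((f 0 ℓ x + f 1 ℓ x) - |f 1 ℓ x - f 0 ℓ x|) := fun x => by
    simp only [stopValue, ← mul_assoc, h0, h1]
    rw [← mul_min_of_nonneg _ _ hc]
    rcases le_total (f 0 ℓ x) (f 1 ℓ x) with h | h
    · rw [min_eq_left h, abs_of_nonneg (sub_nonneg.2 h)]
      ring
    · rw [min_eq_right h, abs_of_nonpos (sub_nonpos.2 h)]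
      ring
  have hi := hf.integrable
  simp only [h]
  rw [integral_const_mul, integral_sub (f := fun x => f 0 ℓ x + f 1 ℓ x)
    (g := fun x => |f 1 ℓ x - f 0 ℓ x|) ((hi 0 ℓ).add (hi 1 ℓ)) ((hi 1 ℓ).sub (hi 0 ℓ)).abs,
    integral_add (hi 0 ℓ) (hi 1 ℓ), hf.integral_eq_one, hf.integral_eq_one]
  ring

/-- At `s` both penalties equal `c = μ₀π₀`, so the total weight is `c (μ₀ + μ₁) / (μ₀ μ₁)`, while
one sample lowers the expected penalty by `c` times the total variation distance. Condition (a)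
compares the two. -/
theorem continueValue_stopValue_lt [NeZero K] (hf : IsSensorFamily ν f) (hμ : ∀ i, 0 < μ i)
    (hprior : ∀ i, 0 < prior i) {C : Fin K → ℝ} {ℓ : Fin K}
    (hℓ : C ℓ < μ 0 * μ 1 / (μ 0 + μ 1) * ((1 / 2) * ∫ x, |f 1 ℓ x - f 0 ℓ x| ∂ν)) {s : ℝ}
    (hs : s = Real.log (μ 0 * prior 0 / (μ 1 * prior 1))) :
    continueValue ν f C (stopValue μ) (llrWeight prior s) < stopValue μ (llrWeight prior s) := by
  have hc := mul_pos (hμ 0) (hprior 0)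
  have h1 := stopValue_llrWeight_of_ge hprior hμ hs.le
  rw [stopValue_llrWeight_of_le hprior hμ hs.ge] at h1
  refine (continueValue_le ℓ _).trans_lt ?_
  rw [stopValue_llrWeight_of_le hprior hμ hs.ge, sampleValue,
    integral_stopValue_eq (p := llrWeight prior s) hf hc.le rfl h1.symm]
  set I := ∫ x, |f 1 ℓ x - f 0 ℓ x| ∂ν
  have hm0 := hμ 0
  have hm1 := hμ 1
  have hsum : llrWeight prior s 0 + llrWeight prior s 1
      = μ 0 * prior 0 * ((μ 0 + μ 1) / (μ 0 * μ 1)) := by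
    have : llrWeight prior s 1 = μ 0 * prior 0 / μ 1 := by
      rw [eq_div_iff hm1.ne', mul_comm]
      exact h1.symm
    rw [this]
    simp only [llrWeight, Matrix.cons_val_zero]
    field_simp
    ring
  have hpos : 0 < (μ 0 + μ 1) / (μ 0 * μ 1) := by positivity
  have h2 : C ℓ * ((μ 0 + μ 1) / (μ 0 * μ 1)) < 1 / 2 * I := by
    calc _ < μ 0 * μ 1 / (μ 0 + μ 1) * (1 / 2 * I) * ((μ 0 + μ 1) / (μ 0 * μ 1)) :=
          mul_lt_mul_of_pos_right hℓ hpos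
      _ = _ := by field_simp
  rw [hsum]
  nlinarith [mul_lt_mul_of_pos_left h2 hc]

end SensorTest

theorem theorem1 {𝓧 : Type*} [MeasurableSpace 𝓧] (ν : Measure 𝓧) [SigmaFinite ν]
    (K N : ℕ) (hK : 0 < K)
    (f : Fin 2 → Fin K → 𝓧 → ℝ) (hf : SensorTest.IsSensorFamily ν f)
    (prior : Fin 2 → ℝ) (hprior : ∀ i, 0 < prior i) (hsum : prior 0 + prior 1 = 1)
    (μ : Fin 2 → ℝ) (hμ : ∀ i, 0 < μ i)
    (Ω : Finset (Fin K)) (lam : Fin K → ℝ) (hlam : ∀ ℓ ∈ Ω, 0 ≤ lam ℓ) :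
    ∃ (P : SensorTest.Procedure K N 𝓧) (ψ : ℕ → ℝ → Fin K) (A B : ℕ → ℝ),
      P.IsOptimal ν f prior μ Ω lam ∧
      -- sensor selection: `δ_{t+1} = ψ_{t+1}(L_t)`
      (∀ t, Measurable (ψ t)) ∧
      (∀ (t : Fin N) (x : Fin N → 𝓧), P.select t x = ψ (t + 1) (P.llr f t x)) ∧
      -- stopping: `T = min {t : L_t ∉ (-A_t, B_t)}`
      (∀ x, IsLeast {t : ℕ | P.llr f t x ∉ Ioo (-A t) (B t)} (P.time x)) ∧
      -- thresholds
      B N = Real.log (μ 0 * prior 0 / (μ 1 * prior 1)) ∧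
      A N = -Real.log (μ 0 * prior 0 / (μ 1 * prior 1)) ∧
      AntitoneOn A (Iic N) ∧ AntitoneOn B (Iic N) ∧
      ((∃ ℓ, SensorTest.sampleCost Ω lam ℓ <
          μ 0 * μ 1 / (μ 0 + μ 1) * ((1 / 2) * ∫ x, |f 1 ℓ x - f 0 ℓ x| ∂ν)) →
        (∀ ℓ, ∀ ε > 0,
          0 < SensorTest.sensorLaw ν f 0 ℓ
            {x | 0 < SensorTest.sampleLLR f ℓ x ∧ SensorTest.sampleLLR f ℓ x < ε} ∧
          0 < SensorTest.sensorLaw ν f 0 ℓ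
            {x | -ε < SensorTest.sampleLLR f ℓ x ∧ SensorTest.sampleLLR f ℓ x < 0}) →
        StrictAntiOn A (Iic N) ∧ StrictAntiOn B (Iic N)) ∧
      -- decision: `H_0` if `L_T ≤ -A_T`, `H_1` if `L_T ≥ B_T`
      -- (in a tie `L_T = -A_T = B_T` both have the same posterior cost, and `H_1` is taken)
      (∀ x, P.llr f (P.time x) x ≤ -A (P.time x) → P.llr f (P.time x) x < B (P.time x) →
        P.decide x = 0) ∧
      (∀ x, B (P.time x) ≤ P.llr f (P.time x) x → P.decide x = 1) := by
  have : NeZero K := ⟨hK.ne'⟩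
  have : Nonempty 𝓧 := by
    by_contra h
    have := not_nonempty_iff.1 h
    simpa using hf.lintegral_eq_one 0 0
  have hC := SensorTest.one_le_sampleCost hlam
  have hV := SensorTest.isCostToGo_value hf hμ hC
  obtain ⟨α, β, hα0, hβ0, hα, hβ, hαβ, hαm, hβm, hstrict⟩ :=
    SensorTest.exists_thresholds hf hμ hC hprior rfl
  -- With `m` samples left before the selection, `m - 1` remain after it; the rule `σ 0` is never
  -- applied.
  choose σ hσm hσ using fun m => SensorTest.exists_measurable_argmin fun ℓ =>
    ((hV (m - 1)).measurable_sampleValue (C := SensorTest.sampleCost Ω lam) hf ℓ).comp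
      (SensorTest.measurable_llrWeight (prior := prior))
  obtain ⟨P, hP⟩ := SensorTest.exists_isThreshold (N := N) (α := α) (β := β) hf.measurable hσm
    (by rw [hα0, hβ0, neg_neg, Ioo_self])
  have hllr : ∀ t x, 0 + P.llr f t x = P.llr f t x := fun t x => zero_add _
  -- The procedure starts at log-likelihood ratio `0`, where the weights are the prior.
  have hw : (1 : ℝ) • SensorTest.llrWeight prior 0 = prior := by
    ext i
    fin_cases i <;> simp [SensorTest.llrWeight]
  have hopt := hP.weightedRisk_eq hf hC hμ hprior rfl hα hβ (fun m => hσ (m + 1)) hαβ zero_le_one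
  rw [hw] at hopt
  -- Time is reversed: `N - t` samples are left after `t`, so `ψ (t + 1) = σ (N - t)`, and monotone
  -- thresholds become antitone.
  refine ⟨P, fun t => σ (N + 1 - t), fun t => α (N - t), fun t => β (N - t), fun Q => ?_,
    fun t => hσm _, fun t x => ?_, fun x => ?_, by simpa using hβ0, by simpa using hα0,
    fun t _ t' _ h => hαm (Nat.sub_le_sub_left h N),
    fun t _ t' _ h => hβm (Nat.sub_le_sub_left h N), fun ⟨ℓ, hℓ⟩ hpos => ?_, fun x => ?_,
    fun x => ?_⟩
  · have hnn : 0 ≤ prior := fun i => (hprior i).le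
    rw [P.risk_eq hf hprior hμ hlam, Q.risk_eq hf hprior hμ hlam]
    refine ENNReal.toReal_mono ?_ (hopt ▸ SensorTest.value_le_weightedRisk hf hC hμ Q hnn)
    exact ENNReal.add_ne_top.2
      ⟨ENNReal.mul_ne_top ENNReal.ofReal_ne_top (Q.condRisk_ne_top hf hC hμ 0),
        ENNReal.mul_ne_top ENNReal.ofReal_ne_top (Q.condRisk_ne_top hf hC hμ 1)⟩
  · rw [hP.select_eq, hllr, ← Nat.add_sub_add_right N 1 t]
  · simpa only [hllr] using hP.isLeast_time x
  -- The sensor law is absolutely continuous with respect to `ν`, so positive probability under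
  -- hypothesis 0 gives positive `ν`-measure.
  · have hnull : ∀ ℓ S, 0 < SensorTest.sensorLaw ν f 0 ℓ S → ν S ≠ 0 := fun ℓ S h h' =>
      h.ne' (withDensity_absolutelyContinuous ν _ h')
    obtain ⟨h1, h2⟩ := hstrict (SensorTest.continueValue_stopValue_lt hf hμ hprior hℓ rfl)
      fun ℓ ε hε => ⟨hnull ℓ _ (hpos ℓ ε hε).1, hnull ℓ _ (hpos ℓ ε hε).2⟩
    have hlt : ∀ {t t'}, t' ∈ Iic N → t < t' → N - t' < N - t := fun h h' =>
      Nat.sub_lt_sub_left (h'.trans_le h) h'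
    exact ⟨fun t _ t' ht' h => h1 (hlt ht' h), fun t _ t' ht' h => h2 (hlt ht' h)⟩
  · simpa only [hllr] using hP.decide_eq_zero x
  · simpa only [hllr] using hP.decide_eq_one x
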